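/- **Setting.** Let $\mathcal X$ be a finite, nonempty abstract simplicial complex with $n$ simplices, $F$ a field, $q\ge 0$ a homology degree. For $f=(f_1,f_2):\mathcal X\to\mathbb R^2$, regarded as a point of $\mathbb R^{2n}$, and $u\in\mathbb R^2$ let $\mathcal X_u$ be the complex of all simplices $\sigma$ with $f(\tau)\le u$ (coordinatewise) for every face $\tau\subseteq\sigma$; if $f$ is monotone under inclusion of faces, this is the sublevel complex $\{\sigma : f(\sigma)\le u\}$. Let $M^f_u=H_q(\mathcal X_u;F)$, with the maps induced by inclusions. For $I\subseteq\mathbb R^2$ nonempty and connected as a poset, $\mathrm{rk}^{M^f}(I)$ is the rank of the canonical map $\varprojlim M^f|_I\to\varinjlim M^f|_I$. For $p\in\mathbb R^2$, an integer $\ell\ge 1$ and $\delta\ge 0$, the $\ell$-worm $W_\delta$ is the union of the closed sup-norm balls of radius $\delta$ centred at $p+(\alpha,-\alpha)$, $|\alpha|\le(\ell-1)\delta$. For an integer $k\ge 1$ let $$\Lambda(f)=\Lambda^{k,\ell}_p(f)=\sup\{\delta\ge 0 : \mathrm{rk}^{M^f}(W_\delta)\ge k\}\qquad(\sup\emptyset=0).$$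 For $g\in\mathbb R^{2n}\setminus\{0\}$ let $$\nabla_g\Lambda(f)=\lim_{\alpha\to 0}\frac{\Lambda(f+\alpha g)-\Lambda(f)}{\alpha\,\|g\|_\infty}$$ (two-sided limit). **Support assignment.** For $f$ with $\delta=\Lambda(f)>0$, let $e_r$ and $e_b$ be the parts of $W_\delta$ on the lines $x+y=p_1+p_2+2\delta$ and $x+y=p_1+p_2-2\delta$ (the upper and lower off-diagonal edges). The support assignment $s_f:\mathcal X\to\{\pm1,0,\pm\ell\}^2$ is given by the following rules, where the first applicable rule is used for each coordinate. For $i=1,2$: 1. $s_f(\sigma)_i=\ell$ if $f(\sigma)_i=p_i+\ell\delta$ (aligned with the right, resp. top, edge of $W_\delta$); 2. $s_f(\sigma)_i=-\ell$ if $f(\sigma)_i=p_i-\ell\delta$ (aligned with the left, resp. bottom, edge); 3. $s_f(\sigma)_i=1$ if $f(\sigma)_i$ is the $i$-th coordinate of a join on $e_r$ in the sense below; 4. $s_f(\sigma)_i=-1$ if $f(\sigma)_i$ is the $i$-th coordinate of a join on $e_b$ in the sense below; 5. $s_f(\sigma)_i=0$ otherwise. In rules 3 and 4 the joins are the points $f(\rho)\vee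 f(\tau)$ (coordinatewise maximum) lying on the given edge, with $\rho,\tau\in\mathcal X$ (possibly equal), $f(\rho)_1\le f(\tau)_1$ and $f(\tau)_2\le f(\rho)_2$; the simplex $\tau$ supplies the first coordinate and $\rho$ the second, i.e. the rules apply to $\sigma=\tau$ for $i=1$ and to $\sigma=\rho$ for $i=2$. **Proposition.** Fix $k,\ell\ge 1$ and $p\in\mathbb R^2$. There is a Lebesgue-null set $Z\subseteq\mathbb R^{2n}$ such that for every $f\in\mathbb R^{2n}\setminus Z$ with $f(\sigma)_1\ne f(\tau)_1$ and $f(\sigma)_2\ne f(\tau)_2$ for all $\sigma\ne\tau$ in $\mathcal X$, there is an assignment $s:\mathcal X\to\{\pm1,0,\pm\ell\}^2$, $s\neq 0$, such that $\nabla_g\Lambda(f)$ exists for every $g\ne 0$, and $$\nabla_s\Lambda(f)=\max_{g\in\mathbb R^{2n}\setminus\{0\}}\nabla_g\Lambda(f).$$ Moreover, if $\Lambda(f)>0$, then $s$ is the support assignment $s_f$. -/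

import Mathlib

open Set Filter Topology MeasureTheory CategoryTheory CategoryTheory.Limits

noncomputable section

namespace GRIL

universe u v w

attribute [local instance 10000] Preorder.smallCategory

/-! ## Simplicial homology of subcomplexes, as a functor -/

section Homology

/-- Formal linear combinations, with coefficients in `F`, of finite sets of vertices. -/
def Chain (F : Type u) [Field F] (V : Type v) : Type (max u v) := Finset V →₀ F

instance (F : Type u) [Field F] (V : Type v) : AddCommGroup (Chain F V) :=
  inferInstanceAs (AddCommGroup (Finset V →₀ F))

instance (F : Type u) [Field F] (V : Type v) : Module F (Chain F V) :=
  inferInstanceAs (Module F (Finset V →₀ F))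

/-- The basis chain of a finite vertex set. -/
def Chain.single (F : Type u) [Field F] {V : Type v} (σ : Finset V) : Chain F V :=
  Finsupp.single σ (1 : F)

/-- The simplicial boundary operator: the `i`-th vertex of `σ` (in increasing order, counted from
`0`) is removed with the sign `(-1) ^ i`. Vertices have boundary zero (unreduced homology). -/
def boundary (F : Type u) [Field F] (V : Type v) [LinearOrder V] : Chain F V →ₗ[F] Chain F V :=
  Finsupp.linearCombination F fun σ : Finset V =>
    if 2 ≤ σ.card then
      ∑ x ∈ σ, (-1 : F) ^ (σ.filter (fun y => y < x)).card • Chain.single F (σ.erase x)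
    else 0

/-- The simplicial `q`-chains of the complex `K`: the span of its simplices with `q + 1`
vertices. -/
def chains (F : Type u) [Field F] {V : Type v} (q : ℕ) (K : PreAbstractSimplicialComplex V) :
    Submodule F (Chain F V) :=
  Finsupp.supported F F {σ : Finset V | σ ∈ K.faces ∧ σ.card = q + 1}

theorem chains_mono (F : Type u) [Field F] {V : Type v} (q : ℕ)
    {K L : PreAbstractSimplicialComplex V} (h : K ≤ L) : chains F q K ≤ chains F q L :=
  Finsupp.supported_mono (M := F) (R := F) fun _ hσ => ⟨h hσ.1, hσ.2⟩

variable (F : Type u) [Field F] {V : Type v} [LinearOrder V]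

/-- The simplicial `q`-cycles of the complex `K`. -/
def cycles (q : ℕ) (K : PreAbstractSimplicialComplex V) : Submodule F (Chain F V) :=
  chains F q K ⊓ LinearMap.ker (boundary F V)

/-- The simplicial `q`-boundaries of the complex `K`. -/
def boundaries (q : ℕ) (K : PreAbstractSimplicialComplex V) : Submodule F (Chain F V) :=
  (chains F (q + 1) K).map (boundary F V)

/-- The `q`-th simplicial homology of `K` with coefficients in `F`: cycles modulo boundaries. -/
abbrev Homology (q : ℕ) (K : PreAbstractSimplicialComplex V) : Type (max u v) :=
  ↥(cycles F q K) ⧸ (boundaries F q K).submoduleOf (cycles F q K)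

theorem cycles_mono (q : ℕ) {K L : PreAbstractSimplicialComplex V} (h : K ≤ L) :
    cycles F q K ≤ cycles F q L :=
  inf_le_inf_right _ (chains_mono F q h)

theorem boundaries_mono (q : ℕ) {K L : PreAbstractSimplicialComplex V} (h : K ≤ L) :
    boundaries F q K ≤ boundaries F q L :=
  Submodule.map_mono (chains_mono F (q + 1) h)

/-- The linear map in homology induced by the inclusion of a subcomplex. -/
def homologyMap (q : ℕ) {K L : PreAbstractSimplicialComplex V} (h : K ≤ L) :
    Homology F q K →ₗ[F] Homology F q L :=
  Submodule.mapQ _ _ (Submodule.inclusion (cycles_mono F q h))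
    fun _ hx => boundaries_mono F q h hx

/-- Simplicial homology as a functor on the poset of complexes on the vertex type `V`. -/
def homologyFunctor (V : Type v) [LinearOrder V] (q : ℕ) :
    PreAbstractSimplicialComplex V ⥤ ModuleCat.{max u v} F where
  obj K := ModuleCat.of F (Homology F q K)
  map h := ModuleCat.ofHom (homologyMap F q h.le)
  map_id K := by
    ext x
    rfl
  map_comp h₁ h₂ := by
    ext x
    rfl

end Homology

/-! ## The two-parameter persistence module of a filtration function -/

section Persistence

variable {V : Type v}

/-- The complex of all simplices of `X` all of whose faces have value at most `u` (in the product
order of the plane). If `f` is monotone under inclusion of faces, this is `{σ | f σ ≤ u}`; for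
arbitrary `f` it is the largest subcomplex of `X` contained in `{σ | f σ ≤ u}`. -/
def sublevel (X : PreAbstractSimplicialComplex V) (f : X.faces → ℝ × ℝ) (u : ℝ × ℝ) :
    PreAbstractSimplicialComplex V where
  faces := {σ | σ ∈ X.faces ∧ ∀ τ : X.faces, (τ : Finset V) ⊆ σ → f τ ≤ u}
  isRelLowerSet_faces := fun _ hσ =>
    ⟨(X.isRelLowerSet_faces hσ.1).1, fun _ hτσ hτ =>
      ⟨(X.isRelLowerSet_faces hσ.1).2 hτσ hτ, fun ρ hρ => hσ.2 ρ (hρ.trans hτσ)⟩⟩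

theorem sublevel_mono (X : PreAbstractSimplicialComplex V) (f : X.faces → ℝ × ℝ) :
    Monotone (sublevel X f) :=
  fun _ _ huv _ hσ => ⟨hσ.1, fun τ hτ => (hσ.2 τ hτ).trans huv⟩

/-- The two-parameter persistence module `M^f` in homology degree `q`. -/
def persistenceModule (F : Type u) [Field F] [LinearOrder V] (q : ℕ)
    (X : PreAbstractSimplicialComplex V) (f : X.faces → ℝ × ℝ) :
    (ℝ × ℝ) ⥤ ModuleCat.{max u v} F :=
  (sublevel_mono X f).functor ⋙ homologyFunctor F V q

end Persistence

/-! ## Generalized rank -/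

section Rank

/-- The canonical map from the limit to the colimit of a diagram of nonempty shape: project to an
object of the diagram and include. For a connected shape it does not depend on the object, see
`limitToColimit_eq`. -/
def limitToColimit {J : Type v} [Category.{w} J] [Nonempty J] {C : Type*} [Category C]
    (D : J ⥤ C) [HasLimit D] [HasColimit D] : limit D ⟶ colimit D :=
  limit.π D (Classical.arbitrary J) ≫ colimit.ι D (Classical.arbitrary J)

theorem limitToColimit_eq {J : Type v} [Category.{w} J] [IsConnected J] {C : Type*} [Category C]
    (D : J ⥤ C) [HasLimit D] [HasColimit D] (j : J) :
    limitToColimit D = limit.π D j ≫ colimit.ι D j :=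
  constant_of_preserves_morphisms (fun j => limit.π D j ≫ colimit.ι D j)
    (fun i j g => by rw [← limit.w D g, Category.assoc, colimit.w]) _ _

/-- The restriction `M|_I` of a persistence module to a subset of the plane. -/
def restrict {F : Type u} [Field F] (M : (ℝ × ℝ) ⥤ ModuleCat.{max u v} F) (I : Set (ℝ × ℝ)) :
    I ⥤ ModuleCat.{max u v} F :=
  Monotone.functor (f := fun u : I => (u : ℝ × ℝ)) (fun _ _ h => h) ⋙ M

/-- The generalized rank of `M` over a nonempty set `I`: the rank of the canonical map from the
limit to the colimit of `M|_I`. -/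
def genRank {F : Type u} [Field F] (M : (ℝ × ℝ) ⥤ ModuleCat.{max u v} F) (I : Set (ℝ × ℝ))
    [Nonempty I] : ℕ :=
  Module.finrank F (LinearMap.range (limitToColimit (restrict M I)).hom)

end Rank

/-! ## Worms and the landscape -/

/-- The `ℓ`-worm of width `δ` centred at `p`: the union of the closed sup-norm balls of radius `δ`
centred on the segment `p + (α, -α)`, `|α| ≤ (ℓ - 1) δ`. -/
def worm (p : ℝ × ℝ) (ℓ : ℕ) (δ : ℝ) : Set (ℝ × ℝ) :=
  ⋃ α ∈ {α : ℝ | |α| ≤ ((ℓ : ℝ) - 1) * δ}, Metric.closedBall (p + (α, -α)) δ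

/-- The generalized rank invariant landscape
`λ^M(p, k, ℓ) = sup {δ ≥ 0 | rk^M (worm p ℓ δ) ≥ k}`, where the supremum of the empty subset of
`[0, ∞)` is `0`. -/
def landscape {F : Type u} [Field F] (M : (ℝ × ℝ) ⥤ ModuleCat.{max u v} F) (p : ℝ × ℝ)
    (k ℓ : ℕ) : ℝ :=
  sSup {δ : ℝ | 0 ≤ δ ∧ ∃ _ : Nonempty (worm p ℓ δ), k ≤ genRank M (worm p ℓ δ)}

/-- The function `Λ_p^{k,ℓ}` on filtration functions. -/
def Lam (F : Type u) [Field F] {V : Type v} [LinearOrder V] (q : ℕ)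
    (X : PreAbstractSimplicialComplex V) (p : ℝ × ℝ) (k ℓ : ℕ) (f : X.faces → ℝ × ℝ) : ℝ :=
  landscape (persistenceModule F q X f) p k ℓ

/-- `d` is the derivative of `Λ` at `f` in the direction `g`, normalized by the sup norm of `g`
(the limit is two-sided). -/
def HasNormalizedDeriv {E : Type*} [NormedAddCommGroup E] [NormedSpace ℝ E] (Λ : E → ℝ)
    (f g : E) (d : ℝ) : Prop :=
  Tendsto (fun α : ℝ => (Λ (f + α • g) - Λ f) / (α * ‖g‖)) (𝓝[≠] 0) (𝓝 d)

/-! ## Support simplices -/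

/-- The off-diagonal edge of the worm which bounds it from above. -/
def upperEdge (p : ℝ × ℝ) (ℓ : ℕ) (δ : ℝ) : Set (ℝ × ℝ) :=
  {w ∈ worm p ℓ δ | w.1 + w.2 = p.1 + p.2 + 2 * δ}

/-- The off-diagonal edge of the worm which bounds it from below. -/
def lowerEdge (p : ℝ × ℝ) (ℓ : ℕ) (δ : ℝ) : Set (ℝ × ℝ) :=
  {w ∈ worm p ℓ δ | w.1 + w.2 = p.1 + p.2 - 2 * δ}

/-- The join `f σ ∨ f τ` lies on `E`, takes its first coordinate from `τ` and its second
coordinate from `σ`. -/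
def JoinOn {ι : Type*} (E : Set (ℝ × ℝ)) (f : ι → ℝ × ℝ) (σ τ : ι) : Prop :=
  f σ ⊔ f τ ∈ E ∧ (f σ).1 ≤ (f τ).1 ∧ (f τ).2 ≤ (f σ).2

open Classical in
/-- The assignment given by the support simplices on the boundary of the worm of width `δ`. A
coordinate of `f σ` aligned with a vertical or horizontal edge gets `± ℓ`; a coordinate of `f σ`
which is a coordinate of a join on an off-diagonal edge gets `± 1`; the sign points outwards. All
other coordinates get `0`. -/
def supportAssignment {ι : Type*} (p : ℝ × ℝ) (ℓ : ℕ) (δ : ℝ) (f : ι → ℝ × ℝ) (σ : ι) : ℝ × ℝ :=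
  (if (f σ).1 = p.1 + ℓ * δ then (ℓ : ℝ)
    else if (f σ).1 = p.1 - ℓ * δ then -(ℓ : ℝ)
    else if ∃ ρ, JoinOn (upperEdge p ℓ δ) f ρ σ then 1
    else if ∃ ρ, JoinOn (lowerEdge p ℓ δ) f ρ σ then -1
    else 0,
   if (f σ).2 = p.2 + ℓ * δ then (ℓ : ℝ)
    else if (f σ).2 = p.2 - ℓ * δ then -(ℓ : ℝ)
    else if ∃ τ, JoinOn (upperEdge p ℓ δ) f σ τ then 1
    else if ∃ τ, JoinOn (lowerEdge p ℓ δ) f σ τ then -1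
    else 0)

end GRIL

end

/-! The landscape `Λ` is 1-Lipschitz for the sup norm: if `f` and `f'` are `ε`-close, diagonal
shifts by `±ε` factor the limit-to-colimit map of `M^f` over the worm of width `δ` through `M^{f'}`
over the worm of width `δ - ε` (`genRank_worm_le_of_dist_le`). By Rademacher, `Λ` is differentiable
off a null set. Where `Λ(f) = 0`, `f` is a global minimum, so there the derivative vanishes and any
nonzero assignment will do.

If `δ = Λ(f) > 0`, the worm of width `δ` must touch the support (`hasSupport_of_Lam_pos`). Otherwise
no coordinate of `f` and no join lies close to the edges, and the rank over the worm of width `δ -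
ε` is at most the rank over that of width `δ + ε`, contradicting the supremum. To see this, the
limit cone and the colimit cocone are extended to the larger worm. A cone extends freely past the
upper diagonal edge. Past the lower one it extends when the sublevel complexes jump in at most one
coordinate direction inside each small cell, because a cell with jumps in both directions contains a
join. Past the sides it extends by clamping. The cocone is the same problem after the point
reflection `u ↦ -u`.

Each way of touching the support determines `δ` as `c·(f - p) / c·c` for one of finitely many
vectors `c` (`supportVector`, `supportWidth`). Off finitely many hyperplanes, different `c` give
different values at `f`, so exactly one `c` occurs at `f`. By continuity it is also the only one
nearby, so `Λ` is this affine function near `f` (`eventually_Lam_eq_supportWidth`), with normalized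
derivative `c·g / (c·c ‖g‖)`. The nonzero entries of `c` have one common absolute value, so Hölder's
inequality is an equality at `g = c`, which makes `c` a steepest direction. -/

noncomputable section

namespace GRIL

universe u v w

attribute [local instance 10000] Preorder.smallCategory

/-! ## Extension of sections over hexagonal regions -/

section Sections

/-- A functor from a preorder to types, in unbundled form. -/
structure PosetSystem (P : Type*) [Preorder P] where
  obj : P → Type w
  map : ∀ {a b : P}, a ≤ b → obj a → obj b
  map_id : ∀ (a : P) (x : obj a), map le_rfl x = x
  map_comp : ∀ {a b c : P} (hab : a ≤ b) (hbc : b ≤ c) (x : obj a),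
    map hbc (map hab x) = map (hab.trans hbc) x

variable {P : Type*} [Preorder P] (H : PosetSystem.{w} P)

/-- A compatible family of elements over the part `I` of a family `K` of points of `P`. -/
def PosetSystem.IsSection (K : ℝ × ℝ → P) (I : Set (ℝ × ℝ)) (s : ∀ u : I, H.obj (K u)) : Prop :=
  ∀ (u v : I), (u : ℝ × ℝ) ≤ v → ∀ h : K u ≤ K v, H.map h (s u) = s v

variable {H} {K : ℝ × ℝ → P} {I : Set (ℝ × ℝ)} {s : ∀ u : I, H.obj (K u)}

theorem PosetSystem.IsSection.agree (hs : H.IsSection K I s) (hK : Monotone K) {u v : I}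
    (huv : (u : ℝ × ℝ) ≤ v) {a : P} (hu : K u ≤ a) (hv : K v ≤ a) :
    H.map hu (s u) = H.map hv (s v) := by
  rw [← hs u v huv (hK huv), H.map_comp]

theorem PosetSystem.map_eq_of_eq {u v : I} (h : u = v) (huv : K u ≤ K v) :
    H.map huv (s u) = s v := by
  subst h
  exact H.map_id _ _

/-- Pulling back a section along a map which need not be monotone. -/
theorem PosetSystem.isSection_pullback {K' : ℝ × ℝ → P} {J : Set (ℝ × ℝ)}
    (a : J → I) (ha : ∀ u : J, K (a u) ≤ K' u)
    (hagree : ∀ (u v : J) (_ : (u : ℝ × ℝ) ≤ v) (h : K (a u) ≤ K' v),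
      H.map h (s (a u)) = H.map (ha v) (s (a v))) :
    H.IsSection K' J fun u => H.map (ha u) (s (a u)) := by
  intro u v huv h
  rw [H.map_comp]
  exact hagree u v huv _

theorem PosetSystem.IsSection.pullback (hs : H.IsSection K I s) (hK : Monotone K)
    {K' : ℝ × ℝ → P} {J : Set (ℝ × ℝ)}
    (a : J → I) (hmono : ∀ u v : J, (u : ℝ × ℝ) ≤ v → (a u : ℝ × ℝ) ≤ a v)
    (ha : ∀ u : J, K (a u) ≤ K' u) :
    H.IsSection K' J fun u => H.map (ha u) (s (a u)) :=
  PosetSystem.isSection_pullback a ha fun u v huv _ => hs.agree hK (hmono u v huv) _ _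

end Sections

/-! ### Enlarging a hexagon across its diagonal edges and its sides -/

section Hexagons

/-- The hexagon `|x|, |y| ≤ L`, `lo ≤ x + y ≤ hi`. -/
def hexagon (L lo hi : ℝ) : Set (ℝ × ℝ) :=
  {u | (-L ≤ u.1 ∧ u.1 ≤ L) ∧ (-L ≤ u.2 ∧ u.2 ≤ L) ∧ lo ≤ u.1 + u.2 ∧ u.1 + u.2 ≤ hi}

theorem zero_mem_hexagon {L lo hi : ℝ} (hL : 0 ≤ L) (hlo : lo ≤ 0) (hhi : 0 ≤ hi) :
    (0 : ℝ × ℝ) ∈ hexagon L lo hi := by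
  simp [hexagon, hL, hlo, hhi]

theorem neg_mem_hexagon {L lo hi : ℝ} {u : ℝ × ℝ} :
    -u ∈ hexagon L lo hi ↔ u ∈ hexagon L (-hi) (-lo) := by
  simp only [hexagon, mem_ofPred_eq, Prod.fst_neg, Prod.snd_neg]
  constructor <;> rintro ⟨⟨_, _⟩, ⟨_, _⟩, _, _⟩ <;>
    refine ⟨⟨?_, ?_⟩, ⟨?_, ?_⟩, ?_, ?_⟩ <;> linarith

variable {P : Type*} [Preorder P] {H : PosetSystem.{w} P} {K : ℝ × ℝ → P}

/-- Sections extend across the upper diagonal edge of a hexagon. -/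
theorem exists_section_extend_upper (hK : Monotone K) {L lo t θ : ℝ}
    (hθt : 2 * θ ≤ t) (hlo : lo ≤ 0) {s : ∀ u : hexagon L lo t, H.obj (K u)}
    (hs : H.IsSection K _ s) :
    ∃ s' : ∀ u : hexagon L lo (t + θ), H.obj (K u), H.IsSection K _ s' ∧
      ∀ (h : (0 : ℝ × ℝ) ∈ hexagon L lo t) (h' : (0 : ℝ × ℝ) ∈ hexagon L lo (t + θ)),
        s' ⟨0, h'⟩ = s ⟨0, h⟩ := by
  have key : ∀ v : hexagon L lo (t + θ), ∃ a : hexagon L lo t, (a : ℝ × ℝ) ≤ v ∧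
      (∀ h : (v : ℝ × ℝ) ∈ hexagon L lo t, a = ⟨v, h⟩) ∧
      ∀ (w : hexagon L lo t) (_ : (w : ℝ × ℝ) ≤ v) (h₁ : K w ≤ K v) (h₂ : K a ≤ K v),
        H.map h₁ (s w) = H.map h₂ (s a) := by
    rintro ⟨v, hv⟩
    by_cases hvI : v ∈ hexagon L lo t
    · exact ⟨⟨v, hvI⟩, le_rfl, fun _ => rfl, fun w hw h₁ h₂ => hs.agree hK hw h₁ h₂⟩
    obtain ⟨⟨h1, h2⟩, ⟨h3, h4⟩, h5, h6⟩ := id hv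
    have hsum : t < v.1 + v.2 := by
      by_contra hc
      exact hvI ⟨⟨h1, h2⟩, ⟨h3, h4⟩, h5, not_lt.1 hc⟩
    -- A diagonal step of length `θ` leads back into the old hexagon, since `v.1 + v.2` exceeds `t`
    -- by at most `θ`; `2 * θ ≤ t` keeps the step from leaving it on the other side.
    refine ⟨⟨(v.1 - θ, v.2 - θ), ?_⟩, ?_, fun h => absurd h hvI, ?_⟩
    · refine ⟨⟨?_, ?_⟩, ⟨?_, ?_⟩, ?_, ?_⟩ <;> dsimp only <;> linarith
    · refine ⟨?_, ?_⟩ <;> dsimp only <;> linarith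
    · rintro ⟨w, hw⟩ hwv hw1 hw2
      obtain ⟨⟨w1, w2⟩, ⟨w3, w4⟩, w5, w6⟩ := id hw
      have hwv1 : w.1 ≤ v.1 := hwv.1
      have hwv2 : w.2 ≤ v.2 := hwv.2
      -- The join of the base point with any old point `w ≤ v` is again old: if one coordinate comes
      -- from each, the sum is at most `v.1 + v.2 - θ ≤ t`. So all old points below `v` induce the
      -- same element at `v`.
      have hj : (w ⊔ (v.1 - θ, v.2 - θ) : ℝ × ℝ) ∈ hexagon L lo t := by
        simp only [hexagon, mem_ofPred_eq, Prod.fst_sup, Prod.snd_sup]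
        rcases max_cases w.1 (v.1 - θ) with ⟨e1, e1'⟩ | ⟨e1, e1'⟩ <;>
          rcases max_cases w.2 (v.2 - θ) with ⟨e2, e2'⟩ | ⟨e2, e2'⟩ <;> rw [e1, e2] <;>
          refine ⟨⟨?_, ?_⟩, ⟨?_, ?_⟩, ?_, ?_⟩ <;> linarith
      have hjv : (w ⊔ (v.1 - θ, v.2 - θ) : ℝ × ℝ) ≤ v :=
        sup_le hwv ⟨by dsimp only; linarith, by dsimp only; linarith⟩
      rw [hs.agree hK (u := ⟨w, hw⟩) (v := ⟨_, hj⟩) le_sup_left hw1 (hK hjv)]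
      exact (hs.agree hK (v := ⟨_, hj⟩) le_sup_right _ (hK hjv)).symm
  choose a hav ha0 ha using key
  refine ⟨fun u => H.map (hK (hav u)) (s (a u)),
    PosetSystem.isSection_pullback a _ fun u v huv h => ?_, fun h h' => ?_⟩
  · exact ha v (a u) ((hav u).trans huv) h _
  · exact PosetSystem.map_eq_of_eq (v := ⟨0, h⟩) (ha0 ⟨0, h'⟩ h) _

/-- Sections extend across the lower diagonal edge of a hexagon if close to each point of the new
part the family `K` jumps in at most one of the two coordinate directions. -/
theorem exists_section_extend_lower (hK : Monotone K) {L hi t θ : ℝ} (hθ : 0 ≤ θ)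
    (hθt : 2 * θ ≤ t) (hhi : 0 ≤ hi)
    (hcell : ∀ u ∈ hexagon L (-(t + θ)) (-t),
      (∀ y, u.2 ≤ y → y ≤ u.2 + θ → K (u.1 + θ, y) ≤ K (u.1, y)) ∨
      (∀ x, u.1 ≤ x → x ≤ u.1 + θ → K (x, u.2 + θ) ≤ K (x, u.2)))
    {s : ∀ u : hexagon L (-t) hi, H.obj (K u)} (hs : H.IsSection K _ s) :
    ∃ s' : ∀ u : hexagon L (-(t + θ)) hi, H.obj (K u), H.IsSection K _ s' ∧
      ∀ (h : (0 : ℝ × ℝ) ∈ hexagon L (-t) hi) (h' : (0 : ℝ × ℝ) ∈ hexagon L (-(t + θ)) hi),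
        s' ⟨0, h'⟩ = s ⟨0, h⟩ := by
  have key : ∀ u : hexagon L (-(t + θ)) hi, ∃ a : hexagon L (-t) hi, (u : ℝ × ℝ) ≤ a ∧
      K a ≤ K u ∧ (∀ h : (u : ℝ × ℝ) ∈ hexagon L (-t) hi, a = ⟨u, h⟩) ∧
      ∀ (v : hexagon L (-t) hi) (_ : (u : ℝ × ℝ) ≤ v) (h₂ : K a ≤ K v),
        H.map h₂ (s a) = s v := by
    rintro ⟨u, hu⟩
    by_cases huI : u ∈ hexagon L (-t) hi
    · exact ⟨⟨u, huI⟩, le_rfl, le_rfl, fun _ => rfl, fun v hv h₂ => hs _ _ hv h₂⟩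
    obtain ⟨⟨h1, h2⟩, ⟨h3, h4⟩, h5, h6⟩ := id hu
    have hsum : u.1 + u.2 < -t := by
      by_contra hc
      exact huI ⟨⟨h1, h2⟩, ⟨h3, h4⟩, not_lt.1 hc, h6⟩
    rcases hcell u ⟨⟨h1, h2⟩, ⟨h3, h4⟩, h5, hsum.le⟩ with hA | hB
    -- Without horizontal jumps in the cell, `K` has the same value at `u` and at its right
    -- neighbour, which is an old point, so the element can be moved down to `u`.
    · refine ⟨⟨(u.1 + θ, u.2), ?_⟩, ?_, hA u.2 le_rfl (by linarith), fun h => absurd h huI, ?_⟩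
      · refine ⟨⟨?_, ?_⟩, ⟨?_, ?_⟩, ?_, ?_⟩ <;> dsimp only <;> linarith
      · refine ⟨?_, ?_⟩ <;> dsimp only <;> linarith
      rintro ⟨v, hv⟩ huv hav
      obtain ⟨⟨v1, v2⟩, ⟨v3, v4⟩, v5, v6⟩ := id hv
      have huv1 : u.1 ≤ v.1 := huv.1
      have huv2 : u.2 ≤ v.2 := huv.2
      by_cases hc : u.1 + θ ≤ v.1
      · exact hs _ _ ⟨hc, huv2⟩ hav
      rw [not_le] at hc
      -- If `v` is not above the neighbour, the comparison runs through a zigzag: up to `(u.1 + θ,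
      -- y)`, back left to `(v.1, y)`, up to `v`. Truncating `y` at `u.2 + θ` keeps the leftward
      -- step inside the cell, where `hA` applies.
      have hv' : ((v.1, min v.2 (u.2 + θ)) : ℝ × ℝ) ∈ hexagon L (-t) hi := by
        rcases min_cases v.2 (u.2 + θ) with ⟨e, e'⟩ | ⟨e, e'⟩ <;> rw [e] <;>
          refine ⟨⟨?_, ?_⟩, ⟨?_, ?_⟩, ?_, ?_⟩ <;> dsimp only <;> linarith
      have hj : ((u.1 + θ, min v.2 (u.2 + θ)) : ℝ × ℝ) ∈ hexagon L (-t) hi := by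
        rcases min_cases v.2 (u.2 + θ) with ⟨e, e'⟩ | ⟨e, e'⟩ <;> rw [e] <;>
          refine ⟨⟨?_, ?_⟩, ⟨?_, ?_⟩, ?_, ?_⟩ <;> dsimp only <;> linarith
      have hm : u.2 ≤ min v.2 (u.2 + θ) := le_min huv2 (by linarith)
      have hKj : K (u.1 + θ, min v.2 (u.2 + θ)) ≤ K (v.1, min v.2 (u.2 + θ)) :=
        (hA _ hm (min_le_right _ _)).trans (hK ⟨huv1, le_rfl⟩)
      have hv'v : ((v.1, min v.2 (u.2 + θ)) : ℝ × ℝ) ≤ v := ⟨le_rfl, min_le_left _ _⟩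
      have hKjv := hKj.trans (hK hv'v)
      rw [hs.agree hK (u := ⟨(u.1 + θ, u.2), _⟩) (v := ⟨_, hj⟩)
          ⟨le_rfl, hm⟩ hav hKjv,
        ← hs.agree hK (u := ⟨_, hv'⟩) (v := ⟨_, hj⟩) ⟨hc.le, le_rfl⟩ (hK hv'v) hKjv]
      exact hs _ ⟨v, hv⟩ hv'v _
    · refine ⟨⟨(u.1, u.2 + θ), ?_⟩, ?_, hB u.1 le_rfl (by linarith), fun h => absurd h huI, ?_⟩
      · refine ⟨⟨?_, ?_⟩, ⟨?_, ?_⟩, ?_, ?_⟩ <;> dsimp only <;> linarith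
      · refine ⟨?_, ?_⟩ <;> dsimp only <;> linarith
      rintro ⟨v, hv⟩ huv hav
      obtain ⟨⟨v1, v2⟩, ⟨v3, v4⟩, v5, v6⟩ := id hv
      have huv1 : u.1 ≤ v.1 := huv.1
      have huv2 : u.2 ≤ v.2 := huv.2
      by_cases hc : u.2 + θ ≤ v.2
      · exact hs _ _ ⟨huv1, hc⟩ hav
      rw [not_le] at hc
      have hv' : ((min v.1 (u.1 + θ), v.2) : ℝ × ℝ) ∈ hexagon L (-t) hi := by
        rcases min_cases v.1 (u.1 + θ) with ⟨e, e'⟩ | ⟨e, e'⟩ <;> rw [e] <;>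
          refine ⟨⟨?_, ?_⟩, ⟨?_, ?_⟩, ?_, ?_⟩ <;> dsimp only <;> linarith
      have hj : ((min v.1 (u.1 + θ), u.2 + θ) : ℝ × ℝ) ∈ hexagon L (-t) hi := by
        rcases min_cases v.1 (u.1 + θ) with ⟨e, e'⟩ | ⟨e, e'⟩ <;> rw [e] <;>
          refine ⟨⟨?_, ?_⟩, ⟨?_, ?_⟩, ?_, ?_⟩ <;> dsimp only <;> linarith
      have hm : u.1 ≤ min v.1 (u.1 + θ) := le_min huv1 (by linarith)
      have hKj : K (min v.1 (u.1 + θ), u.2 + θ) ≤ K (min v.1 (u.1 + θ), v.2) :=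
        (hB _ hm (min_le_right _ _)).trans (hK ⟨le_rfl, huv2⟩)
      have hv'v : ((min v.1 (u.1 + θ), v.2) : ℝ × ℝ) ≤ v := ⟨min_le_left _ _, le_rfl⟩
      have hKjv := hKj.trans (hK hv'v)
      rw [hs.agree hK (u := ⟨(u.1, u.2 + θ), _⟩) (v := ⟨_, hj⟩)
          ⟨hm, le_rfl⟩ hav hKjv,
        ← hs.agree hK (u := ⟨_, hv'⟩) (v := ⟨_, hj⟩) ⟨le_rfl, hc.le⟩ (hK hv'v) hKjv]
      exact hs _ ⟨v, hv⟩ hv'v _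
  choose a hau hKa ha0 ha using key
  refine ⟨fun u => H.map (hKa u) (s (a u)),
    PosetSystem.isSection_pullback a _ fun u v huv h => ?_, fun h h' => ?_⟩
  · have huv' : (u : ℝ × ℝ) ≤ a v := huv.trans (hau v)
    have hK' : K (a u) ≤ K (a v) := (hKa u).trans (hK huv')
    rw [← ha u (a v) huv' hK', H.map_comp]
  · exact PosetSystem.map_eq_of_eq (v := ⟨0, h⟩) (ha0 ⟨0, h'⟩ h) _

/-- The coordinatewise projection to the square `[-L, L]²`. -/
def clampSquare (L : ℝ) (u : ℝ × ℝ) : ℝ × ℝ :=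
  (max (-L) (min L u.1), max (-L) (min L u.2))

theorem clampSquare_mono (L : ℝ) : Monotone (clampSquare L) := fun _ _ h =>
  ⟨max_le_max le_rfl (min_le_min le_rfl h.1), max_le_max le_rfl (min_le_min le_rfl h.2)⟩

theorem clampSquare_zero {L : ℝ} (hL : 0 ≤ L) : clampSquare L 0 = 0 := by
  simp [clampSquare, hL]

theorem clampSquare_neg {L : ℝ} (hL : 0 ≤ L) (u : ℝ × ℝ) :
    clampSquare L (-u) = -clampSquare L u := by
  have h : ∀ x : ℝ, max (-L) (min L (-x)) = -max (-L) (min L x) := by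
    intro x
    rcases min_cases L (-x) with ⟨e, _⟩ | ⟨e, _⟩ <;> rcases min_cases L x with ⟨e', _⟩ | ⟨e', _⟩ <;>
      rw [e, e'] <;> rcases max_cases (-L) L with ⟨e, _⟩ | ⟨e, _⟩ <;>
      rcases max_cases (-L) x with ⟨e', _⟩ | ⟨e', _⟩ <;>
      rcases max_cases (-L) (-x) with ⟨e'', _⟩ | ⟨e'', _⟩ <;> linarith
  ext <;> simp [clampSquare, h]

/-- Clamping moves each coordinate by at most `L' - L`, hence the sum by at most twice that. -/
theorem clampSquare_mem_hexagon {L L' t t' : ℝ} (hL : 0 ≤ L) (hLL : L ≤ L')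
    (ht : t' + 2 * (L' - L) ≤ t) {u : ℝ × ℝ} (hu : u ∈ hexagon L' (-t') t') :
    clampSquare L u ∈ hexagon L (-t) t := by
  obtain ⟨⟨h1, h2⟩, ⟨h3, h4⟩, h5, h6⟩ := hu
  have h : ∀ x : ℝ, -L' ≤ x → x ≤ L' → -L ≤ max (-L) (min L x) ∧ max (-L) (min L x) ≤ L ∧
      x - (L' - L) ≤ max (-L) (min L x) ∧ max (-L) (min L x) ≤ x + (L' - L) := by
    intro x hx hx'
    refine ⟨le_max_left _ _, max_le (by linarith) (min_le_left _ _), ?_, ?_⟩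
    · exact le_max_of_le_right (le_min (by linarith) (by linarith))
    · exact max_le (by linarith) ((min_le_right _ _).trans (by linarith))
  obtain ⟨a1, a2, a3, a4⟩ := h _ h1 h2
  obtain ⟨b1, b2, b3, b4⟩ := h _ h3 h4
  refine ⟨⟨a1, a2⟩, ⟨b1, b2⟩, ?_, ?_⟩ <;> dsimp only [clampSquare] <;> linarith

/-- The section is pulled back along the clamp. Clamping may raise a coordinate, so `hclamp` does
not follow from monotonicity of `K`. -/
theorem exists_section_widen (hK : Monotone K) {L L' t t' : ℝ} (hL : 0 ≤ L) (hLL : L ≤ L')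
    (ht : t' + 2 * (L' - L) ≤ t) (hclamp : ∀ u, -L' ≤ u.1 → u.1 ≤ L' → -L' ≤ u.2 → u.2 ≤ L' →
      K (clampSquare L u) ≤ K u)
    {s : ∀ u : hexagon L (-t) t, H.obj (K u)} (hs : H.IsSection K _ s) :
    ∃ s' : ∀ u : hexagon L' (-t') t', H.obj (K u), H.IsSection K _ s' ∧
      ∀ (h : (0 : ℝ × ℝ) ∈ hexagon L (-t) t) (h' : (0 : ℝ × ℝ) ∈ hexagon L' (-t') t'),
        s' ⟨0, h'⟩ = s ⟨0, h⟩ := by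
  refine ⟨_, hs.pullback hK (fun u => ⟨clampSquare L u, clampSquare_mem_hexagon hL hLL ht u.2⟩)
    (fun u v h => clampSquare_mono L h)
    fun u => hclamp u u.2.1.1 u.2.1.2 u.2.2.1.1 u.2.2.1.2, fun h h' => ?_⟩
  exact PosetSystem.map_eq_of_eq
    (u := ⟨clampSquare L 0, clampSquare_mem_hexagon hL hLL ht h'⟩) (v := ⟨0, h⟩)
    (Subtype.ext (clampSquare_zero hL)) _

/-- Sections extend from a hexagon to a slightly larger one if `K` does not change across the
sides, and jumps in at most one coordinate direction close to each point of the lower diagonal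
edge. -/
theorem exists_section_hexagon (hK : Monotone K) {L L' t t' θ : ℝ} (hL : 0 ≤ L) (hLL : L ≤ L')
    (hθ : 0 ≤ θ) (hθt : 2 * θ ≤ t) (ht : t' + 2 * (L' - L) ≤ t + θ)
    (hclamp : ∀ u, -L' ≤ u.1 → u.1 ≤ L' → -L' ≤ u.2 → u.2 ≤ L' → K (clampSquare L u) ≤ K u)
    (hcell : ∀ u ∈ hexagon L (-(t + θ)) (-t),
      (∀ y, u.2 ≤ y → y ≤ u.2 + θ → K (u.1 + θ, y) ≤ K (u.1, y)) ∨
      (∀ x, u.1 ≤ x → x ≤ u.1 + θ → K (x, u.2 + θ) ≤ K (x, u.2)))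
    {s : ∀ u : hexagon L (-t) t, H.obj (K u)} (hs : H.IsSection K _ s) :
    ∃ s' : ∀ u : hexagon L' (-t') t', H.obj (K u), H.IsSection K _ s' ∧
      ∀ (h : (0 : ℝ × ℝ) ∈ hexagon L (-t) t) (h' : (0 : ℝ × ℝ) ∈ hexagon L' (-t') t'),
        s' ⟨0, h'⟩ = s ⟨0, h⟩ := by
  -- Both diagonal edges move out by `θ` before the sides do: the clamp needs this slack of `2 * (L'
  -- - L)`.
  obtain ⟨s₁, hs₁, e₁⟩ := exists_section_extend_upper hK hθt (by linarith) hs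
  obtain ⟨s₂, hs₂, e₂⟩ := exists_section_extend_lower hK hθ hθt (by linarith) hcell hs₁
  obtain ⟨s₃, hs₃, e₃⟩ := exists_section_widen hK hL hLL ht hclamp hs₂
  refine ⟨s₃, hs₃, fun h h' => ?_⟩
  have h₁ : (0 : ℝ × ℝ) ∈ hexagon L (-t) (t + θ) :=
    zero_mem_hexagon hL (by linarith) (by linarith)
  have h₂ : (0 : ℝ × ℝ) ∈ hexagon L (-(t + θ)) (t + θ) :=
    zero_mem_hexagon hL (by linarith) (by linarith)
  rw [e₃ h₂, e₂ h₁, e₁ h]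

end Hexagons

/-! ## Comparing generalized ranks -/

section RankComparison

/-- Morphisms from a fixed object into a functor. -/
def homSystem {P : Type*} [Preorder P] {C : Type*} [Category.{w} C] (G : P ⥤ C) (T : C) :
    PosetSystem.{w} P where
  obj a := T ⟶ G.obj a
  map h φ := φ ≫ G.map (homOfLE h)
  map_id a φ := by
    rw [show homOfLE (le_refl a) = 𝟙 a from rfl, G.map_id, Category.comp_id]
  map_comp hab hbc φ := by
    rw [Category.assoc, ← G.map_comp, homOfLE_comp]

/-- Morphisms from a functor to a fixed object. -/
def cohomSystem {P : Type*} [Preorder P] {C : Type*} [Category.{w} C] (G : P ⥤ C) (T : C) :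
    PosetSystem.{w} Pᵒᵈ where
  obj a := G.obj (OrderDual.ofDual a) ⟶ T
  map {a b} h φ := G.map (homOfLE (show OrderDual.ofDual b ≤ OrderDual.ofDual a from h)) ≫ φ
  map_id a φ := by
    rw [show homOfLE (le_refl (OrderDual.ofDual a)) = 𝟙 (OrderDual.ofDual a) from rfl, G.map_id,
      Category.id_comp]
  map_comp hab hbc φ := by
    rw [← Category.assoc, ← G.map_comp, homOfLE_comp]

/-- The generalized rank of `M` over `I` is at most that of `M'` over `J` if the canonical map of
the former factors through `M'` over `J`. -/
theorem genRank_le_of_factorization {F : Type u} [Field F]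
    (M M' : (ℝ × ℝ) ⥤ ModuleCat.{max u v} F) (I J : Set (ℝ × ℝ)) [Nonempty I] [Nonempty J]
    [∀ u, Module.Finite F (M'.obj u)] 
    (hJ : ∀ (T : Type (max u v)) (φ : J → T),
      (∀ x y : J, (x : ℝ × ℝ) ≤ y → φ x = φ y) → ∀ x y, φ x = φ y)
    (a : ∀ u : J, limit (restrict M I) ⟶ M'.obj u)
    (ha : ∀ (u v : J) (h : (u : ℝ × ℝ) ≤ v), a u ≫ M'.map (homOfLE h) = a v)
    (b : ∀ u : J, M'.obj u ⟶ colimit (restrict M I))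
    (hb : ∀ (u v : J) (h : (u : ℝ × ℝ) ≤ v), M'.map (homOfLE h) ≫ b v = b u)
    (j : J) (hj : a j ≫ b j = limitToColimit (restrict M I)) :
    genRank M I ≤ genRank M' J := by
  let A : limit (restrict M I) ⟶ limit (restrict M' J) :=
    limit.lift (restrict M' J)
      { pt := limit (restrict M I)
        π :=
          { app := a
            naturality := fun u v h => by
              rw [← ha u v h.le]
              exact Category.id_comp _ } }
  let B : colimit (restrict M' J) ⟶ colimit (restrict M I) :=
    colimit.desc (restrict M' J)
      { pt := colimit (restrict M I)
        ι :=
          { app := b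
            naturality := fun u v h => by
              rw [← hb u v h.le]
              exact (Category.comp_id _).symm } }
  have hA : ∀ u, A ≫ limit.π (restrict M' J) u = a u := fun u => limit.lift_π _ u
  have hB : ∀ u, colimit.ι (restrict M' J) u ≫ B = b u := fun u => colimit.ι_desc _ u
  -- Connectedness of `J` is used here: the factorization at `j` holds at every point, including the
  -- one chosen in `limitToColimit`.
  have hconst : ∀ u, a u ≫ b u = a j ≫ b j := fun u =>
    hJ _ (fun u => a u ≫ b u)
      (fun u v h => by rw [← hb u v h, ← ha u v h, Category.assoc]) u j
  have hcomp : limitToColimit (restrict M I) = A ≫ limitToColimit (restrict M' J) ≫ B := by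
    let i : J := Classical.arbitrary J
    calc limitToColimit (restrict M I)
      _ = a i ≫ b i := ((hconst i).trans hj).symm
      _ = (A ≫ limit.π (restrict M' J) i) ≫ colimit.ι (restrict M' J) i ≫ B :=
        (congrArg₂ (fun x y => x ≫ y) (hA i) (hB i)).symm
      _ = A ≫ limitToColimit (restrict M' J) ≫ B := by
        simp only [limitToColimit, Category.assoc]
        rfl
  -- `finrank` is `0` in infinite dimension, so its monotonicity needs finiteness. The range lies in
  -- the image of a single finite-dimensional `M'.obj u`.
  have hfin : Module.Finite F (LinearMap.range (limitToColimit (restrict M' J)).hom) := by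
    have h : Module.Finite F
        (LinearMap.range (colimit.ι (restrict M' J) (Classical.arbitrary J)).hom) :=
      have : Module.Finite F ((restrict M' J).obj (Classical.arbitrary J)) :=
        inferInstanceAs (Module.Finite F (M'.obj _))
      Module.Finite.range _
    refine Submodule.finiteDimensional_of_le (S₂ := LinearMap.range
      (colimit.ι (restrict M' J) (Classical.arbitrary J)).hom) ?_
    rw [limitToColimit, ModuleCat.hom_comp]
    exact LinearMap.range_comp_le_range _ _
  have hle : LinearMap.range (limitToColimit (restrict M I)).hom ≤
      (LinearMap.range (limitToColimit (restrict M' J)).hom).map B.hom := by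
    rw [hcomp, ModuleCat.hom_comp, ModuleCat.hom_comp, ← LinearMap.range_comp]
    exact LinearMap.range_comp_le_range _ _
  have : Module.Finite F
      ((LinearMap.range (limitToColimit (restrict M' J)).hom).map B.hom) := inferInstance
  exact (Submodule.finrank_mono hle).trans (Submodule.finrank_map_le _ _)

end RankComparison

/-! ## Worms -/

section Worm

variable {p : ℝ × ℝ} {ℓ : ℕ} {δ : ℝ}

/-- A centre parameter `α` must lie in three intervals, one for each coordinate of `u` and one for
the segment. The hexagon inequalities say that these intersect pairwise. -/
theorem mem_worm_iff (hℓ : 1 ≤ ℓ) (hδ : 0 ≤ δ) {u : ℝ × ℝ} :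
    u ∈ worm p ℓ δ ↔ u - p ∈ hexagon (ℓ * δ) (-(2 * δ)) (2 * δ) := by
  have hℓ' : (1 : ℝ) ≤ ℓ := by exact_mod_cast hℓ
  have hm : 0 ≤ ((ℓ : ℝ) - 1) * δ := mul_nonneg (by linarith) hδ
  have hexp : ((ℓ : ℝ) - 1) * δ = ℓ * δ - δ := by ring
  rw [hexp] at hm
  simp only [worm, mem_iUnion, mem_ofPred_eq, Metric.mem_closedBall, Prod.dist_eq, Real.dist_eq,
    max_le_iff, abs_le, hexagon, Prod.fst_add, Prod.snd_add, Prod.fst_sub, Prod.snd_sub, hexp]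
  constructor
  · rintro ⟨α, ⟨h1, h2⟩, ⟨h3, h4⟩, h5, h6⟩
    refine ⟨⟨?_, ?_⟩, ⟨?_, ?_⟩, ?_, ?_⟩ <;> linarith
  · rintro ⟨⟨h1, h2⟩, ⟨h3, h4⟩, h5, h6⟩
    -- The largest left endpoint lies in all three intervals.
    refine ⟨max (max (u.1 - p.1 - δ) (-(u.2 - p.2) - δ)) (-(ℓ * δ - δ)), ⟨?_, ?_⟩, ?_⟩
    · exact le_max_right _ _
    · exact max_le (max_le (by linarith) (by linarith)) (by linarith)
    · rcases max_cases (max (u.1 - p.1 - δ) (-(u.2 - p.2) - δ)) (-(ℓ * δ - δ)) with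
        ⟨e, e'⟩ | ⟨e, e'⟩ <;>
      rcases max_cases (u.1 - p.1 - δ) (-(u.2 - p.2) - δ) with ⟨g, g'⟩ | ⟨g, g'⟩ <;>
      rw [e] <;> (try rw [g]) <;> rw [g] at e' <;>
      refine ⟨⟨?_, ?_⟩, ?_, ?_⟩ <;> linarith

theorem center_mem_worm (hℓ : 1 ≤ ℓ) (hδ : 0 ≤ δ) : p ∈ worm p ℓ δ := by
  rw [mem_worm_iff hℓ hδ, sub_self]
  exact zero_mem_hexagon (by positivity) (by linarith) (by linarith)

theorem nonempty_worm (hℓ : 1 ≤ ℓ) (hδ : 0 ≤ δ) : Nonempty (worm p ℓ δ) :=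
  ⟨p, center_mem_worm hℓ hδ⟩

/-- Worms are connected as posets. -/
theorem eq_of_mem_worm (hδ : 0 ≤ δ) {T : Type*} (φ : worm p ℓ δ → T)
    (hφ : ∀ x y : worm p ℓ δ, (x : ℝ × ℝ) ≤ y → φ x = φ y) (x y : worm p ℓ δ) : φ x = φ y := by
  have hball : ∀ α : ℝ, |α| ≤ ((ℓ : ℝ) - 1) * δ → ∀ u ∈ Metric.closedBall (p + (α, -α)) δ,
      u ∈ worm p ℓ δ := fun α hα u hu => mem_biUnion (x := α) hα hu
  have hcen : ∀ α : ℝ, |α| ≤ ((ℓ : ℝ) - 1) * δ → p + (α, -α) ∈ worm p ℓ δ :=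
    fun α hα => hball α hα _ (Metric.mem_closedBall_self hδ)
  have h1 : ∀ (α : ℝ) (hα : |α| ≤ ((ℓ : ℝ) - 1) * δ) (u : worm p ℓ δ),
      (u : ℝ × ℝ) ∈ Metric.closedBall (p + (α, -α)) δ → φ u = φ ⟨_, hcen α hα⟩ := by
    rintro α hα ⟨u, hu⟩ hu'
    -- A ball is closed under joins, so each of its points is linked to the centre through their
    -- join.
    have hj : u ⊔ (p + (α, -α)) ∈ worm p ℓ δ := by
      refine hball α hα _ ?_
      simp only [Metric.mem_closedBall, Prod.dist_eq, Real.dist_eq, max_le_iff, abs_le,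
        Prod.fst_sup, Prod.snd_sup] at hu' ⊢
      obtain ⟨⟨h1, h2⟩, h3, h4⟩ := hu'
      rcases max_cases u.1 (p + (α, -α)).1 with ⟨e, _⟩ | ⟨e, _⟩ <;>
        rcases max_cases u.2 (p + (α, -α)).2 with ⟨e', _⟩ | ⟨e', _⟩ <;>
        rw [e, e'] <;> refine ⟨⟨?_, ?_⟩, ?_, ?_⟩ <;> linarith
    exact (hφ _ ⟨_, hj⟩ le_sup_left).trans (hφ _ ⟨_, hj⟩ le_sup_right).symm
  have h2 : ∀ (α β : ℝ) (hα : |α| ≤ ((ℓ : ℝ) - 1) * δ) (hβ : |β| ≤ ((ℓ : ℝ) - 1) * δ),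
      |β - α| ≤ δ → φ ⟨_, hcen β hβ⟩ = φ ⟨_, hcen α hα⟩ := by
    intro α β hα hβ hαβ
    refine h1 α hα _ ?_
    simp only [Metric.mem_closedBall, Prod.dist_eq, Real.dist_eq, max_le_iff, Prod.fst_add,
      Prod.snd_add, add_sub_add_left_eq_sub]
    exact ⟨hαβ, by rwa [neg_sub_neg, abs_sub_comm]⟩
  have h3 : ∀ (α : ℝ) (hα : |α| ≤ ((ℓ : ℝ) - 1) * δ) (h0 : |(0 : ℝ)| ≤ ((ℓ : ℝ) - 1) * δ),
      φ ⟨_, hcen α hα⟩ = φ ⟨_, hcen 0 h0⟩ := by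
    intro α hα h0
    rcases Nat.eq_zero_or_pos ℓ with rfl | hℓ
    · have : |α| ≤ -δ := by simpa using hα
      have hα0 : α = 0 := abs_nonpos_iff.1 (by linarith)
      subst hα0
      rfl
    have hℓ' : (0 : ℝ) < ℓ := by exact_mod_cast hℓ
    -- The centre `α` is reached from `0` in `ℓ` steps of length `|α| / ℓ ≤ δ`, each staying within
    -- one ball. The `min` keeps all centres on the segment, so that the induction may run over
    -- every `j`.
    have hstep : ∀ j : ℕ, ∀ hj : |α * (min (j : ℝ) ℓ / ℓ)| ≤ ((ℓ : ℝ) - 1) * δ,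
        φ ⟨_, hcen _ hj⟩ = φ ⟨_, hcen 0 h0⟩ := by
      intro j
      have hle : ∀ j : ℕ, |α * (min (j : ℝ) ℓ / ℓ)| ≤ ((ℓ : ℝ) - 1) * δ := by
        intro j
        have hn : 0 ≤ min (j : ℝ) ℓ / ℓ := by positivity
        rw [abs_mul, abs_of_nonneg hn]
        exact (mul_le_of_le_one_right (abs_nonneg _)
          ((div_le_one hℓ').2 (min_le_right _ _))).trans hα
      induction j with
      | zero =>
        intro hj
        congr 3
        simp
      | succ j ih =>
        intro hj
        refine (h2 _ _ (hle j) hj ?_).trans (ih (hle j))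
        have hd : |min ((j + 1 : ℕ) : ℝ) ℓ - min (j : ℝ) ℓ| ≤ 1 := by
          refine (abs_min_sub_min_le_max _ _ _ _).trans ?_
          simp
        rw [← mul_sub, ← sub_div, abs_mul, abs_div, abs_of_pos hℓ', ← mul_div_assoc,
          div_le_iff₀ hℓ']
        calc |α| * |min ((j + 1 : ℕ) : ℝ) ℓ - min (j : ℝ) ℓ| ≤ |α| * 1 := by gcongr
          _ ≤ δ * ℓ := by linarith
    have he : α * (min (ℓ : ℝ) ℓ / ℓ) = α := by
      rw [min_self, div_self hℓ'.ne', mul_one]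
    have := hstep ℓ (by rwa [he])
    simpa only [he] using this
  have h4 : ∀ x : worm p ℓ δ, ∀ h0 : |(0 : ℝ)| ≤ ((ℓ : ℝ) - 1) * δ, φ x = φ ⟨_, hcen 0 h0⟩ := by
    intro x h0
    obtain ⟨α, hα, hx⟩ := mem_iUnion₂.1 x.2
    exact (h1 α hα x hx).trans (h3 α hα h0)
  have h0 : |(0 : ℝ)| ≤ ((ℓ : ℝ) - 1) * δ := by
    obtain ⟨α, hα, hx⟩ := mem_iUnion₂.1 x.2
    rw [abs_zero]
    exact (abs_nonneg α).trans hα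
  exact (h4 x h0).trans (h4 y h0).symm

end Worm

/-! ### Finite dimensionality of homology and vanishing of the rank -/

section Finiteness

variable (F : Type u) [Field F] {V : Type v} [LinearOrder V]

theorem finite_homology (q : ℕ) {K : PreAbstractSimplicialComplex V} (hK : K.faces.Finite) :
    Module.Finite F (Homology F q K) := by
  have : Module.Finite F (chains F q K) := by
    have : Finite {σ : Finset V | σ ∈ K.faces ∧ σ.card = q + 1} :=
      hK.subset fun _ h => h.1
    exact Module.Finite.equiv (Finsupp.supportedEquivFinsupp
      (M := F) (R := F) {σ : Finset V | σ ∈ K.faces ∧ σ.card = q + 1}).symm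
  have : Module.Finite F (cycles F q K) :=
    Submodule.finiteDimensional_of_le (S₂ := chains F q K) inf_le_left
  infer_instance

theorem subsingleton_homology (q : ℕ) {K : PreAbstractSimplicialComplex V} (hK : K.faces = ∅) :
    Subsingleton (Homology F q K) := by
  have h : chains F q K = ⊥ := by
    simp only [chains, hK, mem_empty_iff_false, false_and]
    exact Finsupp.supported_empty
  have : cycles F q K = ⊥ := by rw [cycles, h, bot_inf_eq]
  have : Subsingleton (cycles F q K) := by rw [this]; infer_instance
  infer_instance

variable (X : PreAbstractSimplicialComplex V)

instance [Fintype X.faces] (q : ℕ) (f : X.faces → ℝ × ℝ) (u : ℝ × ℝ) :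
    Module.Finite F ((persistenceModule F q X f).obj u) :=
  finite_homology F q ((Set.toFinite X.faces).subset fun _ h => h.1)

/-- The limit-to-colimit map factors through every point of the worm, here through the homology of
the empty complex. This bounds the landscape. -/
theorem genRank_worm_eq_zero (q : ℕ) (f : X.faces → ℝ × ℝ) {p : ℝ × ℝ} {ℓ : ℕ} {δ : ℝ}
    (hδ : 0 ≤ δ) [Nonempty (worm p ℓ δ)] {u : ℝ × ℝ} (hu : u ∈ worm p ℓ δ)
    (h : ∀ σ, ¬ f σ ≤ u) : genRank (persistenceModule F q X f) (worm p ℓ δ) = 0 := by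
  set D := restrict (persistenceModule F q X f) (worm p ℓ δ)
  have hemp : (sublevel X f u).faces = ∅ :=
    eq_empty_of_forall_notMem fun σ hσ => h ⟨σ, hσ.1⟩ (hσ.2 _ subset_rfl)
  have hsub : Subsingleton (D.obj ⟨u, hu⟩) := subsingleton_homology F q hemp
  have hzero : limitToColimit D = 0 := by
    have := eq_of_mem_worm hδ (fun j => limit.π D j ≫ colimit.ι D j)
      (fun i j h => by rw [← limit.w D (homOfLE h), Category.assoc, colimit.w])
      (Classical.arbitrary _) ⟨u, hu⟩
    refine this.trans ?_
    have hz : limit.π D ⟨u, hu⟩ = 0 := by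
      ext x
      exact Subsingleton.elim _ _
    exact (congrArg (fun x => x ≫ colimit.ι D ⟨u, hu⟩) hz).trans zero_comp
  rw [genRank, hzero, ModuleCat.hom_zero, LinearMap.range_zero, finrank_bot]

end Finiteness

/-! ### Comparing ranks for nearby filtration functions -/

section Interleaving

variable (F : Type u) [Field F] {V : Type v} [LinearOrder V] (q : ℕ)
  (X : PreAbstractSimplicialComplex V)

/-- The projection of the limit of the persistence module over `I`. -/
def limitLeg (f : X.faces → ℝ × ℝ) {I : Set (ℝ × ℝ)} (u : I) :
    limit (restrict (persistenceModule F q X f) I) ⟶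
      (homologyFunctor F V q).obj (sublevel X f u) :=
  limit.π (restrict (persistenceModule F q X f) I) u

/-- The inclusion into the colimit of the persistence module over `I`. -/
def colimitLeg (f : X.faces → ℝ × ℝ) {I : Set (ℝ × ℝ)} (u : I) :
    (homologyFunctor F V q).obj (sublevel X f u) ⟶
      colimit (restrict (persistenceModule F q X f) I) :=
  colimit.ι (restrict (persistenceModule F q X f) I) u

theorem limitLeg_map (f : X.faces → ℝ × ℝ) {I : Set (ℝ × ℝ)} {u v : I}
    (huv : (u : ℝ × ℝ) ≤ v) (h : sublevel X f u ≤ sublevel X f v) :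
    limitLeg F q X f u ≫ (homologyFunctor F V q).map (homOfLE h) = limitLeg F q X f v :=
  limit.w (restrict (persistenceModule F q X f) I) (homOfLE huv)

theorem map_colimitLeg (f : X.faces → ℝ × ℝ) {I : Set (ℝ × ℝ)} {u v : I}
    (huv : (u : ℝ × ℝ) ≤ v) (h : sublevel X f u ≤ sublevel X f v) :
    (homologyFunctor F V q).map (homOfLE h) ≫ colimitLeg F q X f v = colimitLeg F q X f u :=
  colimit.w (restrict (persistenceModule F q X f) I) (homOfLE huv)

theorem limitLeg_colimitLeg (f : X.faces → ℝ × ℝ) {p : ℝ × ℝ} {ℓ : ℕ} {δ : ℝ} (hδ : 0 ≤ δ)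
    [Nonempty (worm p ℓ δ)] (u : worm p ℓ δ) :
    limitLeg F q X f u ≫ colimitLeg F q X f u =
      limitToColimit (restrict (persistenceModule F q X f) (worm p ℓ δ)) :=
  eq_of_mem_worm hδ (fun j => limitLeg F q X f j ≫ colimitLeg F q X f j)
    (fun i j h => by
      rw [← limitLeg_map F q X f h (sublevel_mono X f h), Category.assoc, map_colimitLeg _ _ _ _ h])
    u (Classical.arbitrary _)

/-- A comparison of generalized ranks over worms from a cone and a cocone. -/
theorem genRank_worm_le_of_legs [Fintype X.faces] {f f' : X.faces → ℝ × ℝ} {p : ℝ × ℝ} {ℓ : ℕ}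
    {δ δ' : ℝ} (hδ' : 0 ≤ δ') [Nonempty (worm p ℓ δ)] [Nonempty (worm p ℓ δ')]
    (a : ∀ u : worm p ℓ δ', limit (restrict (persistenceModule F q X f) (worm p ℓ δ)) ⟶
      (homologyFunctor F V q).obj (sublevel X f' u))
    (ha : ∀ (u v : worm p ℓ δ') (_ : (u : ℝ × ℝ) ≤ v) (h : sublevel X f' u ≤ sublevel X f' v),
      a u ≫ (homologyFunctor F V q).map (homOfLE h) = a v)
    (b : ∀ u : worm p ℓ δ', (homologyFunctor F V q).obj (sublevel X f' u) ⟶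
      colimit (restrict (persistenceModule F q X f) (worm p ℓ δ)))
    (hb : ∀ (u v : worm p ℓ δ') (_ : (u : ℝ × ℝ) ≤ v) (h : sublevel X f' u ≤ sublevel X f' v),
      (homologyFunctor F V q).map (homOfLE h) ≫ b v = b u)
    (j : worm p ℓ δ')
    (hj : a j ≫ b j = limitToColimit (restrict (persistenceModule F q X f) (worm p ℓ δ))) :
    genRank (persistenceModule F q X f) (worm p ℓ δ) ≤
      genRank (persistenceModule F q X f') (worm p ℓ δ') :=
  genRank_le_of_factorization _ _ _ _ (fun _ φ hφ => eq_of_mem_worm hδ' φ hφ)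
    a (fun u v h => ha u v h (sublevel_mono X f' h))
    b (fun u v h => hb u v h (sublevel_mono X f' h)) j hj

theorem sublevel_le_sublevel {V : Type v} {X : PreAbstractSimplicialComplex V}
    {f f' : X.faces → ℝ × ℝ} {u u' : ℝ × ℝ}
    (h : ∀ τ, f τ ≤ u → f' τ ≤ u') : sublevel X f u ≤ sublevel X f' u' :=
  fun _ hσ => ⟨hσ.1, fun τ hτ => h τ (hσ.2 τ hτ)⟩

/-- The generalized rank over a worm at `f` is bounded by the one over a thinner worm at a nearby
filtration function. -/
theorem genRank_worm_le_of_dist_le [Fintype X.faces] {f f' : X.faces → ℝ × ℝ} {p : ℝ × ℝ} {ℓ : ℕ} (hℓ : 1 ≤ ℓ)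
    {δ ε : ℝ} (hε : 0 ≤ ε) (hεδ : ε ≤ δ) (hdist : ∀ σ, dist (f σ) (f' σ) ≤ ε)
    [Nonempty (worm p ℓ δ)] [Nonempty (worm p ℓ (δ - ε))] :
    genRank (persistenceModule F q X f) (worm p ℓ δ) ≤
      genRank (persistenceModule F q X f') (worm p ℓ (δ - ε)) := by
  have hδ : 0 ≤ δ := hε.trans hεδ
  have hℓ' : (1 : ℝ) ≤ ℓ := by exact_mod_cast hℓ
  have hℓε : ε ≤ ℓ * ε := le_mul_of_one_le_left hε hℓ'
  have hdist' : ∀ σ, ((f σ).1 - ε ≤ (f' σ).1 ∧ (f' σ).1 ≤ (f σ).1 + ε) ∧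
      ((f σ).2 - ε ≤ (f' σ).2 ∧ (f' σ).2 ≤ (f σ).2 + ε) := by
    intro σ
    have := hdist σ
    simp only [Prod.dist_eq, Real.dist_eq, max_le_iff, abs_le] at this
    obtain ⟨⟨h1, h2⟩, h3, h4⟩ := this
    refine ⟨⟨?_, ?_⟩, ?_, ?_⟩ <;> linarith
  -- Thinning the worm by `ε` leaves room for diagonal shifts up to `ε`: the sums change by at most
  -- `2 * ε`, the coordinates by `ε ≤ ℓ * ε`.
  have hmem : ∀ (u : worm p ℓ (δ - ε)) (c : ℝ), -ε ≤ c → c ≤ ε →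
      (u : ℝ × ℝ) + (c, c) ∈ worm p ℓ δ := by
    rintro ⟨u, hu⟩ c hc hc'
    rw [mem_worm_iff hℓ (by linarith)] at hu
    rw [mem_worm_iff hℓ hδ]
    simp only [hexagon, mem_ofPred_eq, Prod.fst_sub, Prod.snd_sub, Prod.fst_add, Prod.snd_add,
      mul_sub] at hu ⊢
    obtain ⟨⟨h1, h2⟩, ⟨h3, h4⟩, h5, h6⟩ := hu
    refine ⟨⟨?_, ?_⟩, ⟨?_, ?_⟩, ?_, ?_⟩ <;> linarith
  have hlo : ∀ u : ℝ × ℝ, sublevel X f (u + (-ε, -ε)) ≤ sublevel X f' u := fun u =>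
    sublevel_le_sublevel fun τ h => ⟨by
      have := h.1; simp only [Prod.fst_add] at this; linarith [(hdist' τ).1.2], by
      have := h.2; simp only [Prod.snd_add] at this; linarith [(hdist' τ).2.2]⟩
  have hhi : ∀ u : ℝ × ℝ, sublevel X f' u ≤ sublevel X f (u + (ε, ε)) := fun u =>
    sublevel_le_sublevel fun τ h => ⟨by
      have := h.1; simp only [Prod.fst_add]; linarith [(hdist' τ).1.1], by
      have := h.2; simp only [Prod.snd_add]; linarith [(hdist' τ).2.1]⟩
  have hp : p ∈ worm p ℓ (δ - ε) := center_mem_worm hℓ (by linarith)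
  refine genRank_worm_le_of_legs F q X (by linarith)
    (fun u => limitLeg F q X f ⟨_, hmem u (-ε) le_rfl (by linarith)⟩ ≫
      (homologyFunctor F V q).map (homOfLE (hlo u))) ?_
    (fun u => (homologyFunctor F V q).map (homOfLE (hhi u)) ≫
      colimitLeg F q X f ⟨_, hmem u ε (by linarith) le_rfl⟩) ?_ ⟨p, hp⟩ ?_
  · intro u v huv h
    have huv' : (u : ℝ × ℝ) + (-ε, -ε) ≤ v + (-ε, -ε) := add_le_add huv le_rfl
    rw [← limitLeg_map F q X f (u := ⟨_, hmem u (-ε) le_rfl (by linarith)⟩)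
      (v := ⟨_, hmem v (-ε) le_rfl (by linarith)⟩) huv' (sublevel_mono X f huv'),
      Category.assoc, Category.assoc, ← Functor.map_comp, ← Functor.map_comp, homOfLE_comp,
      homOfLE_comp]
  · intro u v huv h
    have huv' : (u : ℝ × ℝ) + (ε, ε) ≤ v + (ε, ε) := add_le_add huv le_rfl
    rw [← map_colimitLeg F q X f (u := ⟨_, hmem u ε (by linarith) le_rfl⟩)
      (v := ⟨_, hmem v ε (by linarith) le_rfl⟩) huv' (sublevel_mono X f huv'),
      ← Category.assoc, ← Category.assoc, ← Functor.map_comp, ← Functor.map_comp, homOfLE_comp,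
      homOfLE_comp]
  · have hle : p + (-ε, -ε) ≤ p + (ε, ε) :=
      add_le_add le_rfl ⟨by dsimp only; linarith, by dsimp only; linarith⟩
    rw [← limitLeg_colimitLeg F q X f hδ ⟨_, hmem ⟨p, hp⟩ ε (by linarith) le_rfl⟩,
      ← limitLeg_map F q X f (u := ⟨_, hmem ⟨p, hp⟩ (-ε) le_rfl (by linarith)⟩)
      (v := ⟨_, hmem ⟨p, hp⟩ ε (by linarith) le_rfl⟩) hle (sublevel_mono X f hle),
      Category.assoc, Category.assoc, ← Category.assoc ((homologyFunctor F V q).map _), ← Functor.map_comp,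
      homOfLE_comp]

end Interleaving

/-! ## Constancy of the generalized rank away from the support -/

section Jumps

variable {V : Type v} {X : PreAbstractSimplicialComplex V} {f : X.faces → ℝ × ℝ}

/-- If the sublevel complexes jump in both coordinate directions within a small square, then the
square contains a join. -/
theorem sublevel_le_or_le_or_join [Fintype X.faces] (f : X.faces → ℝ × ℝ) (u : ℝ × ℝ) (θ : ℝ) :
    (∀ y, y ≤ u.2 + θ → sublevel X f (u.1 + θ, y) ≤ sublevel X f (u.1, y)) ∨
    (∀ x, x ≤ u.1 + θ → sublevel X f (x, u.2 + θ) ≤ sublevel X f (x, u.2)) ∨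
    ∃ σ τ, (f σ).1 ≤ (f τ).1 ∧ (f τ).2 ≤ (f σ).2 ∧ u.1 < (f τ).1 ∧ (f τ).1 ≤ u.1 + θ ∧
      u.2 < (f σ).2 ∧ (f σ).2 ≤ u.2 + θ := by
  classical
  by_contra! hc
  obtain ⟨⟨y, hy, hA⟩, ⟨x, hx, hB⟩, hC⟩ := hc
  let S : Finset X.faces := {σ | f σ ≤ (u.1 + θ, u.2 + θ)}
  have hτ : ∃ τ ∈ S, u.1 < (f τ).1 := by
    by_contra! h
    refine hA (sublevel_le_sublevel fun τ hτ => ⟨h τ ?_, hτ.2⟩)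
    simpa [S] using hτ.trans (Prod.mk_le_mk.2 ⟨le_rfl, hy⟩)
  have hσ : ∃ σ ∈ S, u.2 < (f σ).2 := by
    by_contra! h
    refine hB (sublevel_le_sublevel fun τ hτ => ⟨hτ.1, h τ ?_⟩)
    simpa [S] using hτ.trans (Prod.mk_le_mk.2 ⟨hx, le_rfl⟩)
  obtain ⟨τ₀, hτ₀, hτ₀'⟩ := hτ
  obtain ⟨σ₀, hσ₀, hσ₀'⟩ := hσ
  -- Among the simplices below the upper right corner, the one with largest first coordinate and the
  -- one with largest second coordinate form the join.
  obtain ⟨τ, hτS, hτ⟩ := S.exists_max_image (fun τ => (f τ).1) ⟨_, hτ₀⟩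
  obtain ⟨σ, hσS, hσ⟩ := S.exists_max_image (fun τ => (f τ).2) ⟨_, hτ₀⟩
  have h1 : f τ ≤ (u.1 + θ, u.2 + θ) := by simpa [S] using hτS
  have h2 : f σ ≤ (u.1 + θ, u.2 + θ) := by simpa [S] using hσS
  exact absurd h2.2 (not_le.2 (hC σ τ (hτ σ hσS) (hσ τ hτS) (hτ₀'.trans_le (hτ _ hτ₀)) h1.1
    (hσ₀'.trans_le (hσ _ hσ₀))))

/-- No value of the function lies in one of the bands in which the vertical and horizontal edges
move when the half side of the bounding square varies from `L` to `L'`. -/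
def AvoidsSides (f : X.faces → ℝ × ℝ) (p : ℝ × ℝ) (L L' : ℝ) : Prop :=
  ∀ σ, ¬ (L ≤ (f σ).1 - p.1 ∧ (f σ).1 - p.1 ≤ L') ∧
    ¬ (L ≤ -((f σ).1 - p.1) ∧ -((f σ).1 - p.1) ≤ L') ∧
    ¬ (L ≤ (f σ).2 - p.2 ∧ (f σ).2 - p.2 ≤ L') ∧
    ¬ (L ≤ -((f σ).2 - p.2) ∧ -((f σ).2 - p.2) ≤ L')

/-- Only raising `x` to `-L` can hurt, and then a counterexample `c` would lie between `x` and `-L`,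
in the excluded band. The next lemma is the mirror image. -/
theorem le_of_le_clamp {L L' c x : ℝ} (hx : -L' ≤ x)
    (h2 : ¬ (L ≤ -c ∧ -c ≤ L')) (hc : c ≤ max (-L) (min L x)) : c ≤ x := by
  by_cases hxL : -L ≤ x
  · exact hc.trans (max_le hxL (min_le_right _ _))
  · rw [not_le] at hxL
    rw [max_eq_left ((min_le_right _ _).trans hxL.le)] at hc
    by_contra hcx
    exact h2 ⟨by linarith, by linarith⟩

theorem le_clamp_of_le {L L' c x : ℝ} (hx : x ≤ L')
    (h1 : ¬ (L ≤ c ∧ c ≤ L')) (hc : c ≤ x) : c ≤ max (-L) (min L x) := by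
  refine le_max_of_le_right (le_min ?_ hc)
  by_contra hcL
  exact h1 ⟨by linarith, by linarith⟩

theorem sublevel_clampSquare_le {p : ℝ × ℝ} {L L' : ℝ} (h : AvoidsSides f p L L')
    {u : ℝ × ℝ} (h1 : -L' ≤ u.1) (h2 : -L' ≤ u.2) :
    sublevel X f (p + clampSquare L u) ≤ sublevel X f (p + u) := by
  refine sublevel_le_sublevel fun τ hτ => ?_
  rw [← sub_le_iff_le_add'] at hτ ⊢
  exact ⟨le_of_le_clamp h1 (h τ).2.1 hτ.1, le_of_le_clamp h2 (h τ).2.2.2 hτ.2⟩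

theorem sublevel_le_clampSquare {p : ℝ × ℝ} {L L' : ℝ} (h : AvoidsSides f p L L')
    {u : ℝ × ℝ} (h1 : u.1 ≤ L') (h2 : u.2 ≤ L') :
    sublevel X f (p + u) ≤ sublevel X f (p + clampSquare L u) := by
  refine sublevel_le_sublevel fun τ hτ => ?_
  rw [← sub_le_iff_le_add'] at hτ ⊢
  exact ⟨le_clamp_of_le h1 (h τ).1 hτ.1, le_clamp_of_le h2 (h τ).2.2.1 hτ.2⟩

/-- No join lies within distance about `θ` of the upper diagonal edge `x + y = t` of a hexagon or
its lower diagonal edge `x + y = -t`. -/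
def AvoidsDiagonals (f : X.faces → ℝ × ℝ) (p : ℝ × ℝ) (L t θ : ℝ) : Prop :=
  ∀ σ τ, (f σ).1 ≤ (f τ).1 → (f τ).2 ≤ (f σ).2 →
    |(f τ).1 - p.1| ≤ L + θ → |(f σ).2 - p.2| ≤ L + θ →
      ¬ (t - 2 * θ ≤ (f τ).1 - p.1 + ((f σ).2 - p.2) ∧
        (f τ).1 - p.1 + ((f σ).2 - p.2) ≤ t + θ) ∧
      ¬ (t - 2 * θ ≤ -((f τ).1 - p.1 + ((f σ).2 - p.2)) ∧
        -((f τ).1 - p.1 + ((f σ).2 - p.2)) ≤ t + θ)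

theorem AvoidsDiagonals.lower [Fintype X.faces] {p : ℝ × ℝ} {L t θ : ℝ}
    (h : AvoidsDiagonals f p L t θ) {u : ℝ × ℝ} (hu : u ∈ hexagon L (-(t + θ)) (-t)) :
    (∀ y, u.2 ≤ y → y ≤ u.2 + θ →
      sublevel X f (p + (u.1 + θ, y)) ≤ sublevel X f (p + (u.1, y))) ∨
    (∀ x, u.1 ≤ x → x ≤ u.1 + θ →
      sublevel X f (p + (x, u.2 + θ)) ≤ sublevel X f (p + (x, u.2))) := by
  obtain ⟨⟨h1, h2⟩, ⟨h3, h4⟩, h5, h6⟩ := hu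
  -- The coordinate sum of a join in the cell exceeds `u.1 + u.2` by at most `2 * θ`; as `-(t + θ) ≤
  -- u.1 + u.2 ≤ -t`, this is the band in `AvoidsDiagonals`.
  rcases sublevel_le_or_le_or_join f (p + u) θ with hA | hB | ⟨σ, τ, g1, g2, g3, g4, g5, g6⟩
  · left
    intro y _ hy
    have := hA (p.2 + y) (by rw [Prod.snd_add]; linarith)
    rwa [Prod.fst_add, add_assoc] at this
  · right
    intro x _ hx
    have := hB (p.1 + x) (by rw [Prod.fst_add]; linarith)
    rwa [Prod.snd_add, add_assoc] at this
  · rw [Prod.fst_add] at g3 g4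
    rw [Prod.snd_add] at g5 g6
    refine absurd ⟨?_, ?_⟩ (h σ τ g1 g2 (abs_le.2 ⟨?_, ?_⟩) (abs_le.2 ⟨?_, ?_⟩)).2 <;> linarith

theorem AvoidsDiagonals.upper [Fintype X.faces] {p : ℝ × ℝ} {L t θ : ℝ}
    (h : AvoidsDiagonals f p L t θ) {u : ℝ × ℝ} (hu : u ∈ hexagon L (-(t + θ)) (-t)) :
    (∀ y, u.2 ≤ y → y ≤ u.2 + θ →
      sublevel X f (p + -(u.1, y)) ≤ sublevel X f (p + -(u.1 + θ, y))) ∨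
    (∀ x, u.1 ≤ x → x ≤ u.1 + θ →
      sublevel X f (p + -(x, u.2)) ≤ sublevel X f (p + -(x, u.2 + θ))) := by
  obtain ⟨⟨h1, h2⟩, ⟨h3, h4⟩, h5, h6⟩ := hu
  -- Reflection turns the cell with lower left corner `u` into the one with upper right corner `-u`,
  -- hence the shift by `(θ, θ)`.
  rcases sublevel_le_or_le_or_join f (p - u - (θ, θ)) θ with
    hA | hB | ⟨σ, τ, g1, g2, g3, g4, g5, g6⟩
  · left
    intro y hy _
    have := hA (p.2 - y) (by simp only [Prod.snd_sub]; linarith)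
    convert this using 2 <;> ext <;> simp only [Prod.fst_sub, Prod.fst_add, Prod.snd_add,
      Prod.fst_neg, Prod.snd_neg] <;> ring
  · right
    intro x hx _
    have := hB (p.1 - x) (by simp only [Prod.fst_sub]; linarith)
    convert this using 2 <;> ext <;> simp only [Prod.snd_sub, Prod.fst_add, Prod.snd_add,
      Prod.fst_neg, Prod.snd_neg] <;> ring
  · simp only [Prod.fst_sub, Prod.snd_sub] at g3 g4 g5 g6
    refine absurd ⟨?_, ?_⟩ (h σ τ g1 g2 (abs_le.2 ⟨?_, ?_⟩) (abs_le.2 ⟨?_, ?_⟩)).1 <;> linarith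

end Jumps

/-! ### Extending cones and cocones to a larger worm -/

section Constancy

variable (F : Type u) [Field F] {V : Type v} [LinearOrder V] (q : ℕ)
  (X : PreAbstractSimplicialComplex V) [Fintype X.faces]

variable {f : X.faces → ℝ × ℝ} {p : ℝ × ℝ} {ℓ : ℕ} {δ δ' θ : ℝ}

/-- The limit cone over a worm extends to a slightly larger worm, if no side and no diagonal edge
meets the support in between. -/
theorem exists_cone_of_avoids (hℓ : 1 ≤ ℓ) (hδ : 0 ≤ δ) (hδδ : δ ≤ δ') (hθδ : θ ≤ δ)
    (hθ : 2 * (ℓ + 1) * (δ' - δ) = θ)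
    (hside : AvoidsSides f p (ℓ * δ) (ℓ * δ')) (hdiag : AvoidsDiagonals f p (ℓ * δ) (2 * δ) θ) :
    ∃ a : ∀ u : worm p ℓ δ', limit (restrict (persistenceModule F q X f) (worm p ℓ δ)) ⟶
        (homologyFunctor F V q).obj (sublevel X f u),
      (∀ (u v : worm p ℓ δ') (_ : (u : ℝ × ℝ) ≤ v) (h : sublevel X f u ≤ sublevel X f v),
        a u ≫ (homologyFunctor F V q).map (homOfLE h) = a v) ∧
      ∀ (hp : p ∈ worm p ℓ δ) (hp' : p ∈ worm p ℓ δ'), a ⟨p, hp'⟩ = limitLeg F q X f ⟨p, hp⟩ := by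
  have hδ' : 0 ≤ δ' := hδ.trans hδδ
  have hθ0 : 0 ≤ θ := by rw [← hθ]; exact mul_nonneg (by positivity) (by linarith)
  have hL : (0 : ℝ) ≤ ℓ * δ := by positivity
  have hLL : (ℓ : ℝ) * δ ≤ ℓ * δ' := by gcongr
  -- Here `θ` gets its factor `2 * (ℓ + 1)`: `2` for the moving diagonals and `2 * ℓ` for clamping
  -- at the moving sides.
  have ht : 2 * δ' + 2 * (ℓ * δ' - ℓ * δ) ≤ 2 * δ + θ := by rw [← hθ]; linarith
  have hmem : ∀ {u : ℝ × ℝ}, u ∈ hexagon (ℓ * δ) (-(2 * δ)) (2 * δ) → p + u ∈ worm p ℓ δ :=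
    fun hu => by rwa [mem_worm_iff hℓ hδ, add_sub_cancel_left]
  have hmem' : ∀ u : worm p ℓ δ', (u : ℝ × ℝ) - p ∈ hexagon (ℓ * δ') (-(2 * δ')) (2 * δ') :=
    fun u => (mem_worm_iff hℓ hδ').1 u.2
  have hK : Monotone fun u : ℝ × ℝ => sublevel X f (p + u) :=
    fun u v h => sublevel_mono X f (add_le_add le_rfl h)
  have hs : (homSystem (homologyFunctor F V q)
      (limit (restrict (persistenceModule F q X f) (worm p ℓ δ)))).IsSection
      (fun u : ℝ × ℝ => sublevel X f (p + u)) (hexagon (ℓ * δ) (-(2 * δ)) (2 * δ))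
      (fun u => limitLeg F q X f ⟨p + u, hmem u.2⟩) := by
    intro u v huv h
    have huv' : p + (u : ℝ × ℝ) ≤ p + v := add_le_add le_rfl huv
    exact limitLeg_map F q X f (u := ⟨p + u, hmem u.2⟩) (v := ⟨p + v, hmem v.2⟩) huv' h
  obtain ⟨a, ha, ha0⟩ := exists_section_hexagon hK hL hLL hθ0 (by linarith) ht
    (fun u h1 _ h2 _ => sublevel_clampSquare_le hside h1 h2) (fun u hu => hdiag.lower hu) hs
  have h0 : (0 : ℝ × ℝ) ∈ hexagon (ℓ * δ) (-(2 * δ)) (2 * δ) :=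
    zero_mem_hexagon hL (by linarith) (by linarith)
  have h0' : (0 : ℝ × ℝ) ∈ hexagon (ℓ * δ') (-(2 * δ')) (2 * δ') :=
    zero_mem_hexagon (hL.trans hLL) (by linarith) (by linarith)
  specialize ha0 h0 h0'
  have e1 : ∀ u : ℝ × ℝ, sublevel X f (p + (u - p)) ≤ sublevel X f u :=
    fun u => sublevel_mono X f (add_sub_cancel _ _).le
  let H := homSystem (homologyFunctor F V q)
    (limit (restrict (persistenceModule F q X f) (worm p ℓ δ)))
  refine ⟨fun u => H.map (e1 u) (a ⟨u - p, hmem' u⟩), fun u v huv h => ?_, fun hp hp' => ?_⟩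
  · exact (H.map_comp (e1 u) h _).trans (ha.agree hK (u := ⟨u - p, hmem' u⟩)
      (v := ⟨v - p, hmem' v⟩) (sub_le_sub_right huv _) _ (e1 v))
  -- The values at `p - p` and at `0` live in different types, so they are compared through the
  -- section property instead of by rewriting.
  · have hz : (0 : ℝ × ℝ) ≤ p - p := (sub_self p).ge
    have h0p : sublevel X f (p + 0) ≤ sublevel X f p := (hK hz).trans (e1 p)
    refine (ha.agree hK (u := ⟨0, h0'⟩) (v := ⟨p - p, hmem' ⟨p, hp'⟩⟩) hz h0p (e1 p)).symm.trans ?_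
    refine (congrArg (H.map h0p) ha0).trans ?_
    exact limitLeg_map F q X f (u := ⟨p + 0, hmem h0⟩) (v := ⟨p, hp⟩) (add_zero p).le h0p

/-- The colimit cocone over a worm extends to a slightly larger worm, if no side and no diagonal
edge meets the support in between. -/
theorem exists_cocone_of_avoids (hℓ : 1 ≤ ℓ) (hδ : 0 ≤ δ) (hδδ : δ ≤ δ') (hθδ : θ ≤ δ)
    (hθ : 2 * (ℓ + 1) * (δ' - δ) = θ)
    (hside : AvoidsSides f p (ℓ * δ) (ℓ * δ')) (hdiag : AvoidsDiagonals f p (ℓ * δ) (2 * δ) θ) :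
    ∃ b : ∀ u : worm p ℓ δ', (homologyFunctor F V q).obj (sublevel X f u) ⟶
        colimit (restrict (persistenceModule F q X f) (worm p ℓ δ)),
      (∀ (u v : worm p ℓ δ') (_ : (u : ℝ × ℝ) ≤ v) (h : sublevel X f u ≤ sublevel X f v),
        (homologyFunctor F V q).map (homOfLE h) ≫ b v = b u) ∧
      ∀ (hp : p ∈ worm p ℓ δ) (hp' : p ∈ worm p ℓ δ'),
        b ⟨p, hp'⟩ = colimitLeg F q X f ⟨p, hp⟩ := by
  have hδ' : 0 ≤ δ' := hδ.trans hδδ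
  have hθ0 : 0 ≤ θ := by rw [← hθ]; exact mul_nonneg (by positivity) (by linarith)
  have hL : (0 : ℝ) ≤ ℓ * δ := by positivity
  have hLL : (ℓ : ℝ) * δ ≤ ℓ * δ' := by gcongr
  have ht : 2 * δ' + 2 * (ℓ * δ' - ℓ * δ) ≤ 2 * δ + θ := by rw [← hθ]; linarith
  have hneg : ∀ {L t : ℝ} {u : ℝ × ℝ}, u ∈ hexagon L (-t) t → -u ∈ hexagon L (-t) t :=
    fun hu => by rwa [neg_mem_hexagon, neg_neg]
  have hmem : ∀ {u : ℝ × ℝ}, u ∈ hexagon (ℓ * δ) (-(2 * δ)) (2 * δ) → p + -u ∈ worm p ℓ δ :=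
    fun hu => by rw [mem_worm_iff hℓ hδ, add_sub_cancel_left]; exact hneg hu
  have hmem' : ∀ u : worm p ℓ δ', -((u : ℝ × ℝ) - p) ∈ hexagon (ℓ * δ') (-(2 * δ')) (2 * δ') :=
    fun u => hneg ((mem_worm_iff hℓ hδ').1 u.2)
  -- Reflecting the plane and dualizing the target turns a cocone into a section on the same
  -- symmetric hexagon; the upper edges take the role of the lower ones.
  have hK : Monotone fun u : ℝ × ℝ => OrderDual.toDual (sublevel X f (p + -u)) :=
    fun u v h => sublevel_mono X f (add_le_add le_rfl (neg_le_neg h))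
  have hs : (cohomSystem (homologyFunctor F V q)
      (colimit (restrict (persistenceModule F q X f) (worm p ℓ δ)))).IsSection
      (fun u : ℝ × ℝ => OrderDual.toDual (sublevel X f (p + -u)))
      (hexagon (ℓ * δ) (-(2 * δ)) (2 * δ))
      (fun u => colimitLeg F q X f ⟨p + -u, hmem u.2⟩) := by
    intro u v huv h
    have huv' : p + -(v : ℝ × ℝ) ≤ p + -u := add_le_add le_rfl (neg_le_neg huv)
    exact map_colimitLeg F q X f (u := ⟨p + -v, hmem v.2⟩) (v := ⟨p + -u, hmem u.2⟩) huv' h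
  obtain ⟨b, hb, hb0⟩ := exists_section_hexagon hK hL hLL hθ0 (by linarith) ht
    (fun u h1 h1' h2 h2' => by
      have := sublevel_le_clampSquare hside (u := -u) (by rw [Prod.fst_neg]; linarith)
        (by rw [Prod.snd_neg]; linarith)
      rwa [clampSquare_neg hL] at this)
    (fun u hu => hdiag.upper hu) hs
  have h0 : (0 : ℝ × ℝ) ∈ hexagon (ℓ * δ) (-(2 * δ)) (2 * δ) :=
    zero_mem_hexagon hL (by linarith) (by linarith)
  have h0' : (0 : ℝ × ℝ) ∈ hexagon (ℓ * δ') (-(2 * δ')) (2 * δ') :=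
    zero_mem_hexagon (hL.trans hLL) (by linarith) (by linarith)
  specialize hb0 h0 h0'
  have e1 : ∀ u : ℝ × ℝ, sublevel X f u ≤ sublevel X f (p + -(-(u - p))) :=
    fun u => sublevel_mono X f (by rw [neg_neg, add_sub_cancel])
  let H := cohomSystem (homologyFunctor F V q)
    (colimit (restrict (persistenceModule F q X f) (worm p ℓ δ)))
  have e1' : ∀ u : ℝ × ℝ, OrderDual.toDual (sublevel X f (p + -(-(u - p)))) ≤
    OrderDual.toDual (sublevel X f u) := e1
  refine ⟨fun u => H.map (e1' u) (b ⟨-(u - p), hmem' u⟩), fun u v huv h => ?_, fun hp hp' => ?_⟩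
  · have h' : OrderDual.toDual (sublevel X f v) ≤ OrderDual.toDual (sublevel X f u) := h
    exact (H.map_comp (e1' v) h' _).trans (hb.agree hK (u := ⟨-(v - p), hmem' v⟩)
      (v := ⟨-(u - p), hmem' u⟩) (neg_le_neg (sub_le_sub_right huv _)) _ (e1' u))
  · have hz : (0 : ℝ × ℝ) ≤ -(p - p) := by rw [sub_self, neg_zero]
    have h0p : OrderDual.toDual (sublevel X f (p + -0)) ≤ OrderDual.toDual (sublevel X f p) :=
      (hK hz).trans (e1' p)
    refine (hb.agree hK (u := ⟨0, h0'⟩) (v := ⟨-(p - p), hmem' ⟨p, hp'⟩⟩) hz h0p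
      (e1' p)).symm.trans ?_
    refine (congrArg (H.map h0p) hb0).trans ?_
    have hpe : p ≤ p + -0 := by rw [neg_zero, add_zero]
    exact map_colimitLeg F q X f (u := ⟨p, hp⟩) (v := ⟨p + -0, hmem h0⟩) hpe h0p

/-- The generalized rank over a worm is bounded by that over a slightly larger worm, if no side
and no diagonal edge meets the support in between. -/
theorem genRank_worm_le_of_avoids (hℓ : 1 ≤ ℓ) (hδ : 0 ≤ δ) (hδδ : δ ≤ δ') (hθδ : θ ≤ δ)
    (hθ : 2 * (ℓ + 1) * (δ' - δ) = θ)
    (hside : AvoidsSides f p (ℓ * δ) (ℓ * δ')) (hdiag : AvoidsDiagonals f p (ℓ * δ) (2 * δ) θ)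
    [Nonempty (worm p ℓ δ)] [Nonempty (worm p ℓ δ')] :
    genRank (persistenceModule F q X f) (worm p ℓ δ) ≤
      genRank (persistenceModule F q X f) (worm p ℓ δ') := by
  have hδ' : 0 ≤ δ' := hδ.trans hδδ
  have hp : p ∈ worm p ℓ δ' := center_mem_worm hℓ hδ'
  have hpδ : p ∈ worm p ℓ δ := center_mem_worm hℓ hδ
  obtain ⟨a, ha, ha0⟩ := exists_cone_of_avoids F q X hℓ hδ hδδ hθδ hθ hside hdiag
  obtain ⟨b, hb, hb0⟩ := exists_cocone_of_avoids F q X hℓ hδ hδδ hθδ hθ hside hdiag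
  refine genRank_worm_le_of_legs F q X hδ' a ha b hb ⟨p, hp⟩ ?_
  rw [ha0 hpδ, hb0 hpδ, limitLeg_colimitLeg F q X f hδ]

end Constancy

/-! ## The landscape as a function of the filtration -/

section Landscape

variable (F : Type u) [Field F] {V : Type v} [LinearOrder V] (q : ℕ)
  (X : PreAbstractSimplicialComplex V) (p : ℝ × ℝ) (k ℓ : ℕ)

/-- The widths of worms over which the generalized rank is at least `k`. -/
def rankWidths (f : X.faces → ℝ × ℝ) : Set ℝ :=
  {δ : ℝ | 0 ≤ δ ∧ ∃ _ : Nonempty (worm p ℓ δ),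
    k ≤ genRank (persistenceModule F q X f) (worm p ℓ δ)}

theorem Lam_eq_sSup (f : X.faces → ℝ × ℝ) :
    Lam F q X p k ℓ f = sSup (rankWidths F q X p k ℓ f) := rfl

theorem Lam_nonneg (f : X.faces → ℝ × ℝ) : 0 ≤ Lam F q X p k ℓ f :=
  Real.sSup_nonneg fun _ h => h.1

variable [Fintype X.faces] {k ℓ}

/-- A wide worm contains `p - (δ, δ)`, which lies below no value of `f`, so the rank is `0 < k`. -/
theorem bddAbove_rankWidths (hk : 1 ≤ k) (hℓ : 1 ≤ ℓ) (f : X.faces → ℝ × ℝ) :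
    BddAbove (rankWidths F q X p k ℓ f) := by
  refine ⟨∑ σ, |p.1 - (f σ).1|, fun δ hδ => ?_⟩
  obtain ⟨hδ0, hne, hrank⟩ := hδ
  have hℓδ : δ ≤ ℓ * δ := le_mul_of_one_le_left hδ0 (by exact_mod_cast hℓ)
  by_contra! hlt
  have hu : p - (δ, δ) ∈ worm p ℓ δ := by
    rw [mem_worm_iff hℓ hδ0]
    simp only [hexagon, mem_ofPred_eq, Prod.fst_sub, Prod.snd_sub]
    refine ⟨⟨?_, ?_⟩, ⟨?_, ?_⟩, ?_, ?_⟩ <;> linarith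
  rw [genRank_worm_eq_zero F X q f hδ0 hu] at hrank
  · omega
  · intro σ hσ
    have h1 := hσ.1
    rw [Prod.fst_sub] at h1
    have h2 : |p.1 - (f σ).1| ≤ ∑ σ, |p.1 - (f σ).1| :=
      Finset.single_le_sum (fun σ _ => abs_nonneg (p.1 - (f σ).1)) (Finset.mem_univ σ)
    linarith [le_abs_self (p.1 - (f σ).1)]

variable {F q X p}

/-- Used for `f' ≠ f` to get the Lipschitz bound, and for `f' = f` to see that the admissible widths
are closed downwards. -/
theorem sub_mem_rankWidths (hℓ : 1 ≤ ℓ) {f f' : X.faces → ℝ × ℝ} {δ ε : ℝ}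
    (hδ : δ ∈ rankWidths F q X p k ℓ f) (hε : 0 ≤ ε) (hεδ : ε ≤ δ)
    (hdist : ∀ σ, dist (f σ) (f' σ) ≤ ε) : δ - ε ∈ rankWidths F q X p k ℓ f' := by
  obtain ⟨hδ0, hne, hrank⟩ := hδ
  have hne' : Nonempty (worm p ℓ (δ - ε)) := nonempty_worm hℓ (by linarith)
  exact ⟨by linarith, hne', hrank.trans (genRank_worm_le_of_dist_le F q X hℓ hε hεδ hdist)⟩

variable (F q X p)

theorem lipschitzWith_Lam (hk : 1 ≤ k) (hℓ : 1 ≤ ℓ) : LipschitzWith 1 (Lam F q X p k ℓ) := by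
  refine LipschitzWith.of_le_add fun f f' => ?_
  refine Real.sSup_le (fun δ hδ => ?_) (add_nonneg (Lam_nonneg F q X p k ℓ f') dist_nonneg)
  rcases le_total δ (dist f f') with h | h
  · linarith [Lam_nonneg F q X p k ℓ f']
  · have := le_csSup (bddAbove_rankWidths F q X p hk hℓ f')
      (sub_mem_rankWidths hℓ hδ dist_nonneg h fun σ => dist_le_pi_dist f f' σ)
    rw [← Lam_eq_sSup] at this
    linarith

end Landscape

/-! ### The worm at a positive landscape value touches the support -/

section Support

variable {V : Type v} {X : PreAbstractSimplicialComplex V}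

/-- The worm of width `δ` has a support simplex or a pair of support simplices on its boundary. -/
def HasSupport {ι : Type*} (p : ℝ × ℝ) (ℓ : ℕ) (δ : ℝ) (f : ι → ℝ × ℝ) : Prop :=
  (∃ σ, ((f σ).1 = p.1 + ℓ * δ ∨ (f σ).1 = p.1 - ℓ * δ) ∨
    ((f σ).2 = p.2 + ℓ * δ ∨ (f σ).2 = p.2 - ℓ * δ)) ∨
  ∃ σ τ, JoinOn (upperEdge p ℓ δ) f σ τ ∨ JoinOn (lowerEdge p ℓ δ) f σ τ

theorem eventually_avoids_side {L δ c : ℝ} (hc : c ≠ L * δ) :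
    ∀ᶠ ε : ℝ in 𝓝 0, ¬ (L * (δ - ε) ≤ c ∧ c ≤ L * (δ + ε)) := by
  rcases hc.lt_or_gt with h | h
  · have : ∀ᶠ ε : ℝ in 𝓝 0, c < L * (δ - ε) :=
      (isOpen_lt continuous_const (by fun_prop)).mem_nhds (by simpa using h)
    filter_upwards [this] with ε hε hc
    exact absurd hc.1 (not_le.2 hε)
  · have : ∀ᶠ ε : ℝ in 𝓝 0, L * (δ + ε) < c :=
      (isOpen_lt (by fun_prop) continuous_const).mem_nhds (by simpa using h)
    filter_upwards [this] with ε hε hc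
    exact absurd hc.2 (not_le.2 hε)

/-- The condition at `ε = 0` fails through a strict inequality, which persists for small `ε`. -/
theorem eventually_avoids_diagonal {L δ C a b : ℝ}
    (h : ¬ (|a| ≤ L * δ ∧ |b| ≤ L * δ ∧ a + b = 2 * δ)) :
    ∀ᶠ ε : ℝ in 𝓝 0, |a| ≤ L * (δ - ε) + C * ε → |b| ≤ L * (δ - ε) + C * ε →
      ¬ (2 * (δ - ε) - 2 * (C * ε) ≤ a + b ∧ a + b ≤ 2 * (δ - ε) + C * ε) := by
  rw [not_and_or, not_and_or, not_le, not_le] at h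
  rcases h with h | h | h
  · have : ∀ᶠ ε : ℝ in 𝓝 0, L * (δ - ε) + C * ε < |a| :=
      (isOpen_lt (by fun_prop) continuous_const).mem_nhds (by simpa using h)
    filter_upwards [this] with ε hε ha
    exact absurd ha (not_le.2 hε)
  · have : ∀ᶠ ε : ℝ in 𝓝 0, L * (δ - ε) + C * ε < |b| :=
      (isOpen_lt (by fun_prop) continuous_const).mem_nhds (by simpa using h)
    filter_upwards [this] with ε hε _ hb
    exact absurd hb (not_le.2 hε)
  · rcases lt_or_gt_of_ne h with h | h
    · have : ∀ᶠ ε : ℝ in 𝓝 0, a + b < 2 * (δ - ε) - 2 * (C * ε) :=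
        (isOpen_lt continuous_const (by fun_prop)).mem_nhds (by simpa using h)
      filter_upwards [this] with ε hε _ _ hs
      exact absurd hs.1 (not_le.2 hε)
    · have : ∀ᶠ ε : ℝ in 𝓝 0, 2 * (δ - ε) + C * ε < a + b :=
        (isOpen_lt (by fun_prop) continuous_const).mem_nhds (by simpa using h)
      filter_upwards [this] with ε hε _ _ hs
      exact absurd hs.2 (not_le.2 hε)

theorem joinOn_upperEdge_iff {ι : Type*} {p : ℝ × ℝ} {ℓ : ℕ} (hℓ : 1 ≤ ℓ) {δ : ℝ} (hδ : 0 ≤ δ)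
    {f : ι → ℝ × ℝ} {σ τ : ι} (h1 : (f σ).1 ≤ (f τ).1) (h2 : (f τ).2 ≤ (f σ).2) :
    JoinOn (upperEdge p ℓ δ) f σ τ ↔ |(f τ).1 - p.1| ≤ ℓ * δ ∧ |(f σ).2 - p.2| ≤ ℓ * δ ∧
      (f τ).1 - p.1 + ((f σ).2 - p.2) = 2 * δ := by
  have he : f σ ⊔ f τ = ((f τ).1, (f σ).2) := Prod.ext (max_eq_right h1) (max_eq_left h2)
  simp only [JoinOn, h1, h2, and_true, he, upperEdge, mem_ofPred_eq, mem_worm_iff hℓ hδ, hexagon,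
    Prod.fst_sub, Prod.snd_sub, abs_le]
  constructor
  · rintro ⟨⟨h3, h4, h5⟩, h6⟩
    exact ⟨h3, h4, by linarith⟩
  · rintro ⟨h3, h4, h5⟩
    exact ⟨⟨h3, h4, by linarith, by linarith⟩, by linarith⟩

theorem joinOn_lowerEdge_iff {ι : Type*} {p : ℝ × ℝ} {ℓ : ℕ} (hℓ : 1 ≤ ℓ) {δ : ℝ} (hδ : 0 ≤ δ)
    {f : ι → ℝ × ℝ} {σ τ : ι} (h1 : (f σ).1 ≤ (f τ).1) (h2 : (f τ).2 ≤ (f σ).2) :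
    JoinOn (lowerEdge p ℓ δ) f σ τ ↔ |(f τ).1 - p.1| ≤ ℓ * δ ∧ |(f σ).2 - p.2| ≤ ℓ * δ ∧
      (f τ).1 - p.1 + ((f σ).2 - p.2) = -(2 * δ) := by
  have he : f σ ⊔ f τ = ((f τ).1, (f σ).2) := Prod.ext (max_eq_right h1) (max_eq_left h2)
  simp only [JoinOn, h1, h2, and_true, he, lowerEdge, mem_ofPred_eq, mem_worm_iff hℓ hδ, hexagon,
    Prod.fst_sub, Prod.snd_sub, abs_le]
  constructor
  · rintro ⟨⟨h3, h4, h5⟩, h6⟩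
    exact ⟨h3, h4, by linarith⟩
  · rintro ⟨h3, h4, h5⟩
    exact ⟨⟨h3, h4, by linarith, by linarith⟩, by linarith⟩

theorem eventually_avoids [Fintype X.faces] {p : ℝ × ℝ} {ℓ : ℕ} (hℓ : 1 ≤ ℓ) {δ : ℝ} (hδ : 0 ≤ δ)
    {f : X.faces → ℝ × ℝ} (hf : ¬ HasSupport p ℓ δ f) (C : ℝ) :
    ∀ᶠ ε : ℝ in 𝓝 0, AvoidsSides f p (ℓ * (δ - ε)) (ℓ * (δ + ε)) ∧
      AvoidsDiagonals f p (ℓ * (δ - ε)) (2 * (δ - ε)) (C * ε) := by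
  simp only [HasSupport, not_or, not_exists] at hf
  obtain ⟨h1, h2⟩ := hf
  refine Filter.Eventually.and ?_ ?_
  · refine eventually_all.2 fun σ => ?_
    obtain ⟨⟨a1, a2⟩, a3, a4⟩ := h1 σ
    exact (eventually_avoids_side fun h => a1 (by linarith)).and
      ((eventually_avoids_side fun h => a2 (by linarith)).and
      ((eventually_avoids_side fun h => a3 (by linarith)).and
      (eventually_avoids_side fun h => a4 (by linarith))))
  · refine eventually_all.2 fun σ => eventually_all.2 fun τ => ?_
    obtain ⟨b1, b2⟩ := h2 σ τ
    by_cases h12 : (f σ).1 ≤ (f τ).1 ∧ (f τ).2 ≤ (f σ).2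
    · rw [joinOn_upperEdge_iff hℓ hδ h12.1 h12.2] at b1
      rw [joinOn_lowerEdge_iff hℓ hδ h12.1 h12.2] at b2
      have b2' : ¬ (|-((f τ).1 - p.1)| ≤ ℓ * δ ∧ |-((f σ).2 - p.2)| ≤ ℓ * δ ∧
          -((f τ).1 - p.1) + -((f σ).2 - p.2) = 2 * δ) := by
        rw [abs_neg, abs_neg]
        exact fun h => b2 ⟨h.1, h.2.1, by linarith [h.2.2]⟩
      filter_upwards [eventually_avoids_diagonal (C := C) b1,
        eventually_avoids_diagonal (C := C) b2'] with ε hε hε' _ _ g1 g2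
      rw [abs_neg, abs_neg, ← neg_add] at hε'
      exact ⟨hε g1 g2, hε' g1 g2⟩
    · exact Eventually.of_forall fun ε g1 g2 => absurd ⟨g1, g2⟩ h12

variable (F : Type u) [Field F] [LinearOrder V] (q : ℕ) {k ℓ : ℕ} (p : ℝ × ℝ)

variable (X) in
/-- At a positive value of the landscape, the boundary of the worm meets the support. -/
theorem hasSupport_of_Lam_pos [Fintype X.faces] (hk : 1 ≤ k) (hℓ : 1 ≤ ℓ) {f : X.faces → ℝ × ℝ}
    (hpos : 0 < Lam F q X p k ℓ f) : HasSupport p ℓ (Lam F q X p k ℓ f) f := by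
  by_contra hsup
  set δ := Lam F q X p k ℓ f with hδ
  have hbdd := bddAbove_rankWidths F q X p hk hℓ f
  -- The width grows from `δ - ε` to `δ + ε`, so `θ = 2 * (ℓ + 1) * (2 * ε)`.
  have hev := eventually_avoids hℓ hpos.le hsup (4 * (ℓ + 1))
  have hsmall : ∀ᶠ ε : ℝ in 𝓝 0, 4 * (ℓ + 1) * ε < δ - ε :=
    (isOpen_lt (by fun_prop) (by fun_prop)).mem_nhds (by simpa using hpos)
  obtain ⟨ε, ⟨⟨hside, hdiag⟩, hlt⟩, hε⟩ :=
    (((hev.and hsmall).filter_mono nhdsWithin_le_nhds).and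
      (self_mem_nhdsWithin (s := Ioi (0 : ℝ)))).exists
  have hε : 0 < ε := hε
  have hεδ : 0 < δ - ε := lt_trans (by positivity) hlt
  have hne : (rankWidths F q X p k ℓ f).Nonempty := by
    rw [nonempty_iff_ne_empty]
    intro h
    rw [hδ, Lam_eq_sSup, h, Real.sSup_empty] at hpos
    exact lt_irrefl _ hpos
  obtain ⟨δ₁, hδ₁, hlt₁⟩ := exists_lt_of_lt_csSup hne
    (show δ - ε < sSup (rankWidths F q X p k ℓ f) by rw [← Lam_eq_sSup, ← hδ]; linarith)
  -- The supremum need not be attained, but `δ - ε` lies below an admissible width and is therefore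
  -- admissible.
  have hmem := sub_mem_rankWidths (f' := f) hℓ hδ₁ (ε := δ₁ - (δ - ε)) (by linarith)
    (by linarith) (fun σ => by rw [dist_self]; linarith)
  rw [sub_sub_cancel] at hmem
  obtain ⟨_, hne₁, hrank⟩ := hmem
  have hne₂ : Nonempty (worm p ℓ (δ + ε)) := nonempty_worm hℓ (by linarith)
  have hmem' : δ + ε ∈ rankWidths F q X p k ℓ f :=
    ⟨by linarith, hne₂, hrank.trans (genRank_worm_le_of_avoids F q X hℓ hεδ.le (by linarith)
      hlt.le (by ring) hside hdiag)⟩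
  have := le_csSup hbdd hmem'
  rw [← Lam_eq_sSup, ← hδ] at this
  linarith

end Support

/-! ## Support vectors -/

section SupportVectors

variable {ι : Type*} [Fintype ι]

/-- The Euclidean inner product of assignments, as a linear map in the second variable. -/
def dot (c : ι → ℝ × ℝ) : (ι → ℝ × ℝ) →ₗ[ℝ] ℝ where
  toFun g := ∑ σ, ((c σ).1 * (g σ).1 + (c σ).2 * (g σ).2)
  map_add' g g' := by
    rw [← Finset.sum_add_distrib]
    exact Finset.sum_congr rfl fun σ _ => by simp only [Pi.add_apply, Prod.fst_add, Prod.snd_add]; ring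
  map_smul' a g := by
    rw [RingHom.id_apply, smul_eq_mul, Finset.mul_sum]
    refine Finset.sum_congr rfl fun σ _ => ?_
    simp only [Pi.smul_apply, Prod.smul_fst, Prod.smul_snd, smul_eq_mul]
    ring

theorem dot_apply (c g : ι → ℝ × ℝ) :
    dot c g = ∑ σ, ((c σ).1 * (g σ).1 + (c σ).2 * (g σ).2) := rfl

theorem dot_comm (c g : ι → ℝ × ℝ) : dot c g = dot g c := by
  simp only [dot_apply, mul_comm]

theorem dot_sub_smul_left (a b : ℝ) (c c' g : ι → ℝ × ℝ) :
    dot (a • c - b • c') g = a * dot c g - b * dot c' g := by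
  rw [dot_comm, map_sub, map_smul, map_smul, dot_comm g, dot_comm g, smul_eq_mul, smul_eq_mul]

theorem dot_add_left (c c' g : ι → ℝ × ℝ) : dot (c + c') g = dot c g + dot c' g := by
  rw [dot_comm, map_add, dot_comm g, dot_comm g]

theorem dot_neg_left (c g : ι → ℝ × ℝ) : dot (-c) g = -dot c g := by
  rw [dot_comm, map_neg, dot_comm g]

theorem dot_self_pos {c : ι → ℝ × ℝ} (hc : c ≠ 0) : 0 < dot c c := by
  obtain ⟨σ, hσ⟩ := Function.ne_iff.1 hc
  rw [dot_apply]
  refine Finset.sum_pos' (fun σ _ => add_nonneg (mul_self_nonneg _) (mul_self_nonneg _)) ⟨σ, Finset.mem_univ _, ?_⟩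
  by_contra! h
  refine hσ (Prod.ext ?_ ?_) <;> simp only [Pi.zero_apply, Prod.fst_zero, Prod.snd_zero] <;>
    nlinarith [mul_self_nonneg (c σ).1, mul_self_nonneg (c σ).2]

/-- The width of the worm centred at `p` on whose boundary the support given by `c` lies. -/
def supportWidth (p : ℝ × ℝ) (c f : ι → ℝ × ℝ) : ℝ :=
  dot c (f - fun _ => p) / dot c c

/-- The difference of the two widths is the inner product of `f - p` with `c / c·c - c' / c'·c'`.
This is nonzero because the inversion `c ↦ c / c·c` is injective, so the set is a translated
hyperplane. -/
theorem volume_supportWidth_eq (p : ℝ × ℝ) {c c' : ι → ℝ × ℝ} (hc : c ≠ 0) (hc' : c' ≠ 0)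
    (hne : c ≠ c') : volume {f | supportWidth p c f = supportWidth p c' f} = 0 := by
  set d := (dot c c)⁻¹ • c - (dot c' c')⁻¹ • c' with hd
  have hd0 : d ≠ 0 := by
    intro h
    have h1 := (dot_self_pos hc).ne'
    have h2 := (dot_self_pos hc').ne'
    have heq : (dot c c)⁻¹ • c = (dot c' c')⁻¹ • c' := sub_eq_zero.1 (hd ▸ h)
    have hself : ∀ e : ι → ℝ × ℝ, dot e e ≠ 0 →
        dot ((dot e e)⁻¹ • e) ((dot e e)⁻¹ • e) = (dot e e)⁻¹ := by
      intro e he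
      rw [map_smul, dot_comm (_ • e) e, map_smul, smul_eq_mul, smul_eq_mul, inv_mul_cancel₀ he,
        mul_one]
    have h3 := hself c h1
    rw [heq, hself c' h2] at h3
    rw [h3] at heq
    exact hne (smul_right_injective _ (inv_ne_zero h1) heq)
  have hker : LinearMap.ker (dot d) ≠ ⊤ := by
    intro h
    have : d ∈ LinearMap.ker (dot d) := h ▸ Submodule.mem_top
    exact (dot_self_pos hd0).ne' this
  have hset : {f | supportWidth p c f = supportWidth p c' f} =
      (fun f => f + -(fun _ => p)) ⁻¹' (LinearMap.ker (dot d) : Set (ι → ℝ × ℝ)) := by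
    ext f
    simp only [mem_ofPred_eq, mem_preimage, SetLike.mem_coe, LinearMap.mem_ker, hd,
      dot_sub_smul_left, supportWidth, div_eq_inv_mul, sub_eq_zero, ← sub_eq_add_neg]
  rw [hset, measure_preimage_add_right]
  exact Measure.addHaar_submodule _ _ hker

theorem continuous_supportWidth (p : ℝ × ℝ) (c : ι → ℝ × ℝ) :
    Continuous (supportWidth p c) :=
  ((dot c).continuous_of_finiteDimensional.comp (continuous_id.sub continuous_const)).div_const _

theorem supportWidth_add_smul (p : ℝ × ℝ) (c f g : ι → ℝ × ℝ) (α : ℝ) :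
    supportWidth p c (f + α • g) = supportWidth p c f + α * (dot c g / dot c c) := by
  rw [supportWidth, supportWidth, add_sub_right_comm, map_add, map_smul, smul_eq_mul, add_div,
    mul_div_assoc]

variable [DecidableEq ι]

/-- The assignments with a single entry `ℓ`, and the assignments with an entry `1` in the first
coordinate and an entry `1` in the second. -/
def positiveSupportVector (ℓ : ℕ) : ι ⊕ ι ⊕ ι × ι → ι → ℝ × ℝ
  | .inl σ => Pi.single σ ((ℓ : ℝ), 0)
  | .inr (.inl σ) => Pi.single σ (0, (ℓ : ℝ))
  | .inr (.inr (σ, τ)) => Pi.single τ (1, 0) + Pi.single σ (0, 1)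

/-- The possible support assignments of a function with a single support simplex or pair of
support simplices. -/
def supportVector (ℓ : ℕ) (i : Bool × (ι ⊕ ι ⊕ ι × ι)) : ι → ℝ × ℝ :=
  if i.1 then positiveSupportVector ℓ i.2 else -positiveSupportVector ℓ i.2

theorem dot_single (σ : ι) (a : ℝ × ℝ) (g : ι → ℝ × ℝ) :
    dot (Pi.single σ a) g = a.1 * (g σ).1 + a.2 * (g σ).2 := by
  rw [dot_apply, Finset.sum_eq_single σ]
  · rw [Pi.single_eq_same]
  · intro τ _ h
    rw [Pi.single_eq_of_ne h]
    simp
  · exact fun h => absurd (Finset.mem_univ _) h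

theorem dot_positive_self (ℓ : ℕ) (i : ι ⊕ ι ⊕ ι × ι) :
    dot (positiveSupportVector ℓ i) (positiveSupportVector ℓ i) =
      match i with
      | .inl _ => (ℓ : ℝ) * ℓ
      | .inr (.inl _) => (ℓ : ℝ) * ℓ
      | .inr (.inr _) => 2 := by
  rcases i with σ | σ | ⟨σ, τ⟩
  · simp [positiveSupportVector, dot_single]
  · simp [positiveSupportVector, dot_single]
  · have h1 : ((Pi.single σ ((0 : ℝ), (1 : ℝ)) : ι → ℝ × ℝ) τ).1 = 0 := by
      by_cases h : τ = σ
      · subst h; simp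
      · simp [Pi.single_eq_of_ne h]
    have h2 : ((Pi.single τ ((1 : ℝ), (0 : ℝ)) : ι → ℝ × ℝ) σ).2 = 0 := by
      by_cases h : σ = τ
      · subst h; simp
      · simp [Pi.single_eq_of_ne h]
    simp [positiveSupportVector, dot_add_left, dot_single, h1, h2]
    norm_num

theorem dot_supportVector_self (ℓ : ℕ) (i : Bool × (ι ⊕ ι ⊕ ι × ι)) :
    dot (supportVector ℓ i) (supportVector ℓ i) =
      dot (positiveSupportVector ℓ i.2) (positiveSupportVector ℓ i.2) := by
  rw [supportVector]
  split_ifs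
  · rfl
  · rw [dot_neg_left, map_neg, neg_neg]

theorem supportVector_ne_zero {ℓ : ℕ} (hℓ : 1 ≤ ℓ) (i : Bool × (ι ⊕ ι ⊕ ι × ι)) :
    supportVector ℓ i ≠ 0 := by
  have hℓ' : (0 : ℝ) < ℓ := by exact_mod_cast hℓ
  intro h
  have h1 := dot_supportVector_self ℓ i
  rw [h, map_zero, dot_positive_self] at h1
  rcases i with ⟨b, σ | σ | ⟨σ, τ⟩⟩ <;> dsimp only at h1
  · exact (mul_pos hℓ' hℓ').ne h1
  · exact (mul_pos hℓ' hℓ').ne h1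
  · norm_num at h1

/-- Hölder's inequality bounds `|c·g|` by the 1-norm of `c` times `‖g‖`. For a vector whose nonzero
entries have equal absolute value, the product of 1-norm and sup norm is `c·c`. -/
theorem abs_dot_positive_mul_norm_le (ℓ : ℕ) (i : ι ⊕ ι ⊕ ι × ι) (g : ι → ℝ × ℝ) :
    |dot (positiveSupportVector ℓ i) g| * ‖positiveSupportVector ℓ i‖ ≤
      dot (positiveSupportVector ℓ i) (positiveSupportVector ℓ i) * ‖g‖ := by
  have hg1 : ∀ σ, |(g σ).1| ≤ ‖g‖ := fun σ =>
    (norm_fst_le (g σ)).trans (norm_le_pi_norm g σ)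
  have hg2 : ∀ σ, |(g σ).2| ≤ ‖g‖ := fun σ =>
    (norm_snd_le (g σ)).trans (norm_le_pi_norm g σ)
  have hsingle : ∀ (σ : ι) (a : ℝ × ℝ), ‖(Pi.single σ a : ι → ℝ × ℝ)‖ ≤ ‖a‖ := by
    intro σ a
    refine (pi_norm_le_iff_of_nonneg (norm_nonneg _)).2 fun τ => ?_
    by_cases h : τ = σ
    · subst h; simp
    · simp [Pi.single_eq_of_ne h]
  rw [dot_positive_self]
  rcases i with σ | σ | ⟨σ, τ⟩ <;> dsimp only [positiveSupportVector]
  · have hn := hsingle σ ((ℓ : ℝ), 0)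
    simp only [Prod.norm_mk, norm_zero, Real.norm_natCast, Nat.cast_nonneg, sup_of_le_left] at hn
    rw [dot_single]
    simp only [zero_mul, add_zero, abs_mul, Nat.abs_cast]
    calc (ℓ : ℝ) * |(g σ).1| * _ ≤ ℓ * ‖g‖ * ℓ := by gcongr; exact hg1 σ
      _ = ℓ * ℓ * ‖g‖ := by ring
  · have hn := hsingle σ (0, (ℓ : ℝ))
    simp only [Prod.norm_mk, norm_zero, Real.norm_natCast, Nat.cast_nonneg,
      sup_of_le_right] at hn
    rw [dot_single]
    simp only [zero_mul, zero_add, abs_mul, Nat.abs_cast]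
    calc (ℓ : ℝ) * |(g σ).2| * _ ≤ ℓ * ‖g‖ * ℓ := by gcongr; exact hg2 σ
      _ = ℓ * ℓ * ‖g‖ := by ring
  · have hn : ‖(Pi.single τ (1, 0) + Pi.single σ (0, 1) : ι → ℝ × ℝ)‖ ≤ 1 := by
      refine (pi_norm_le_iff_of_nonneg zero_le_one).2 fun ρ => ?_
      by_cases h1 : ρ = τ <;> by_cases h2 : ρ = σ <;>
        simp [Pi.single_apply, h1, h2, Prod.norm_def]
      all_goals split_ifs <;> simp
    rw [dot_add_left, dot_single, dot_single]
    simp only [zero_mul, add_zero, zero_add, one_mul]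
    have hsum : |(g τ).1 + (g σ).2| ≤ 2 * ‖g‖ :=
      (abs_add_le _ _).trans (by linarith [hg1 τ, hg2 σ])
    calc |(g τ).1 + (g σ).2| * _ ≤ |(g τ).1 + (g σ).2| * 1 := by gcongr
      _ ≤ 2 * ‖g‖ := by linarith

theorem dot_supportVector_mul_norm_le (ℓ : ℕ) (i : Bool × (ι ⊕ ι ⊕ ι × ι)) (g : ι → ℝ × ℝ) :
    dot (supportVector ℓ i) g * ‖supportVector ℓ i‖ ≤
      dot (supportVector ℓ i) (supportVector ℓ i) * ‖g‖ := by
  rw [dot_supportVector_self]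
  refine le_trans ?_ (abs_dot_positive_mul_norm_le ℓ i.2 g)
  rw [supportVector]
  split_ifs
  · exact mul_le_mul_of_nonneg_right (le_abs_self _) (norm_nonneg _)
  · rw [norm_neg, dot_neg_left]
    exact mul_le_mul_of_nonneg_right (neg_le_abs _) (norm_nonneg _)

/-- The support condition on the boundary of the worm that corresponds to a support vector. -/
def IsActive (p : ℝ × ℝ) (ℓ : ℕ) (δ : ℝ) (f : ι → ℝ × ℝ) : Bool × (ι ⊕ ι ⊕ ι × ι) → Prop
  | (true, .inl σ) => (f σ).1 = p.1 + ℓ * δ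
  | (false, .inl σ) => (f σ).1 = p.1 - ℓ * δ
  | (true, .inr (.inl σ)) => (f σ).2 = p.2 + ℓ * δ
  | (false, .inr (.inl σ)) => (f σ).2 = p.2 - ℓ * δ
  | (true, .inr (.inr (σ, τ))) => JoinOn (upperEdge p ℓ δ) f σ τ
  | (false, .inr (.inr (σ, τ))) => JoinOn (lowerEdge p ℓ δ) f σ τ

theorem HasSupport.exists_isActive {κ : Type*} {p : ℝ × ℝ} {ℓ : ℕ} {δ : ℝ} {f : κ → ℝ × ℝ}
    (h : HasSupport p ℓ δ f) : ∃ i, IsActive p ℓ δ f i := by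
  rcases h with ⟨σ, (h | h) | h | h⟩ | ⟨σ, τ, h | h⟩
  · exact ⟨(true, .inl σ), h⟩
  · exact ⟨(false, .inl σ), h⟩
  · exact ⟨(true, .inr (.inl σ)), h⟩
  · exact ⟨(false, .inr (.inl σ)), h⟩
  · exact ⟨(true, .inr (.inr (σ, τ))), h⟩
  · exact ⟨(false, .inr (.inr (σ, τ))), h⟩

/-- Every active condition is a linear equation `c·(f - p) = (c·c) δ`, with `c·c` equal to `ℓ * ℓ`
or `2`. It therefore determines the width. -/
theorem IsActive.supportWidth_eq {p : ℝ × ℝ} {ℓ : ℕ} (hℓ : 1 ≤ ℓ) {δ : ℝ} (hδ : 0 ≤ δ)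
    {f : ι → ℝ × ℝ} {i : Bool × (ι ⊕ ι ⊕ ι × ι)} (h : IsActive p ℓ δ f i) :
    supportWidth p (supportVector ℓ i) f = δ := by
  have hℓ' : (0 : ℝ) < ℓ := by exact_mod_cast hℓ
  rw [supportWidth, dot_supportVector_self, dot_positive_self]
  rcases i with ⟨b, σ | σ | ⟨σ, τ⟩⟩
  · rw [div_eq_iff (by positivity)]
    cases b <;> simp only [IsActive] at h <;>
      simp [supportVector, positiveSupportVector, dot_neg_left, dot_single, h] <;> ring
  · rw [div_eq_iff (by positivity)]
    cases b <;> simp only [IsActive] at h <;>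
      simp [supportVector, positiveSupportVector, dot_neg_left, dot_single, h] <;> ring
  · rw [div_eq_iff (by positivity)]
    cases b <;> simp only [IsActive] at h
    · have := ((joinOn_lowerEdge_iff hℓ hδ h.2.1 h.2.2).1 h).2.2
      simp [supportVector, positiveSupportVector, dot_neg_left, dot_add_left, dot_single]
      linarith
    · have := ((joinOn_upperEdge_iff hℓ hδ h.2.1 h.2.2).1 h).2.2
      simp [supportVector, positiveSupportVector, dot_add_left, dot_single]
      linarith

/-- If all active support conditions belong to the same vector, then this vector is the support
assignment. -/
theorem supportAssignment_eq {p : ℝ × ℝ} {ℓ : ℕ} {δ : ℝ} {f c : ι → ℝ × ℝ}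
    (hex : ∃ i, IsActive p ℓ δ f i) (huniq : ∀ i, IsActive p ℓ δ f i → supportVector ℓ i = c) :
    supportAssignment p ℓ δ f = c := by
  funext σ
  refine Prod.ext ?_ ?_ <;> dsimp only [supportAssignment]
  · split_ifs with h1 h2 h3 h4
    · rw [← huniq (true, .inl σ) h1]; simp [supportVector, positiveSupportVector]
    · rw [← huniq (false, .inl σ) h2]; simp [supportVector, positiveSupportVector]
    · obtain ⟨ρ, h3⟩ := h3
      rw [← huniq (true, .inr (.inr (ρ, σ))) h3]
      simp [supportVector, positiveSupportVector, Pi.single_apply]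
      split_ifs <;> rfl
    · obtain ⟨ρ, h4⟩ := h4
      rw [← huniq (false, .inr (.inr (ρ, σ))) h4]
      simp [supportVector, positiveSupportVector, Pi.single_apply]
      split_ifs <;> rfl
    · obtain ⟨i, hi⟩ := hex
      rw [← huniq i hi]
      rcases i with ⟨b, τ | τ | ⟨ρ, τ⟩⟩
      · by_cases h : σ = τ
        · subst h
          cases b
          · exact absurd hi h2
          · exact absurd hi h1
        · cases b <;> simp [supportVector, positiveSupportVector, Pi.single_eq_of_ne h]
      · cases b <;> simp [supportVector, positiveSupportVector, Pi.single_apply] <;>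
          split_ifs <;> rfl
      · by_cases h : σ = τ
        · subst h
          cases b
          · exact absurd ⟨ρ, hi⟩ h4
          · exact absurd ⟨ρ, hi⟩ h3
        · cases b <;> simp [supportVector, positiveSupportVector, Pi.single_apply, h] <;>
            split_ifs <;> rfl
  · split_ifs with h1 h2 h3 h4
    · rw [← huniq (true, .inr (.inl σ)) h1]; simp [supportVector, positiveSupportVector]
    · rw [← huniq (false, .inr (.inl σ)) h2]; simp [supportVector, positiveSupportVector]
    · obtain ⟨τ, h3⟩ := h3
      rw [← huniq (true, .inr (.inr (σ, τ))) h3]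
      simp [supportVector, positiveSupportVector, Pi.single_apply]
      split_ifs <;> rfl
    · obtain ⟨τ, h4⟩ := h4
      rw [← huniq (false, .inr (.inr (σ, τ))) h4]
      simp [supportVector, positiveSupportVector, Pi.single_apply]
      split_ifs <;> rfl
    · obtain ⟨i, hi⟩ := hex
      rw [← huniq i hi]
      rcases i with ⟨b, τ | τ | ⟨τ, ρ⟩⟩
      · cases b <;> simp [supportVector, positiveSupportVector, Pi.single_apply] <;>
          split_ifs <;> rfl
      · by_cases h : σ = τ
        · subst h
          cases b
          · exact absurd hi h2
          · exact absurd hi h1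
        · cases b <;> simp [supportVector, positiveSupportVector, Pi.single_eq_of_ne h]
      · by_cases h : σ = τ
        · subst h
          cases b
          · exact absurd ⟨ρ, hi⟩ h4
          · exact absurd ⟨ρ, hi⟩ h3
        · cases b <;> simp [supportVector, positiveSupportVector, Pi.single_apply, h] <;>
            split_ifs <;> rfl

end SupportVectors

/-! ## Derivatives of the landscape -/

section Derivative

variable {E : Type*} [NormedAddCommGroup E] [NormedSpace ℝ E] {Λ : E → ℝ} {f g : E}

theorem HasNormalizedDeriv.unique {d d' : ℝ} (h : HasNormalizedDeriv Λ f g d)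
    (h' : HasNormalizedDeriv Λ f g d') : d = d' :=
  tendsto_nhds_unique h h'

theorem hasNormalizedDeriv_of_hasFDerivAt {L : E →L[ℝ] ℝ} (h : HasFDerivAt Λ L f) (g : E) :
    HasNormalizedDeriv Λ f g (L g / ‖g‖) := by
  have h1 := (h.hasLineDerivAt g).tendsto_slope_zero.div_const ‖g‖
  refine h1.congr fun α => ?_
  rw [smul_eq_mul, inv_mul_eq_div, div_div]

/-- A local affine formula for a function yields its normalized derivatives. -/
theorem hasNormalizedDeriv_of_eventually {a : ℝ}
    (h : ∀ᶠ α : ℝ in 𝓝 0, Λ (f + α • g) = Λ f + α * a) :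
    HasNormalizedDeriv Λ f g (a / ‖g‖) := by
  refine tendsto_const_nhds.congr' ?_
  filter_upwards [h.filter_mono nhdsWithin_le_nhds, self_mem_nhdsWithin] with α hα hα0
  rw [hα, add_sub_cancel_left, mul_div_mul_left _ _ hα0]

end Derivative

/-! ### The landscape is locally affine at generic functions -/

section Main

variable {F : Type u} [Field F] {V : Type v} [LinearOrder V] {q : ℕ}
  {X : PreAbstractSimplicialComplex V} [Fintype X.faces] {p : ℝ × ℝ} {k ℓ : ℕ}

/-- Close to a generic function with positive landscape value, the landscape is the affine
function belonging to its support. -/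
theorem eventually_Lam_eq_supportWidth [DecidableEq X.faces] (hk : 1 ≤ k) (hℓ : 1 ≤ ℓ)
    {f : X.faces → ℝ × ℝ}
    (hgen : ∀ i j : Bool × (X.faces ⊕ X.faces ⊕ X.faces × X.faces),
      supportVector ℓ i ≠ supportVector ℓ j →
        supportWidth p (supportVector ℓ i) f ≠ supportWidth p (supportVector ℓ j) f)
    (hpos : 0 < Lam F q X p k ℓ f) :
    ∃ i : Bool × (X.faces ⊕ X.faces ⊕ X.faces × X.faces),
      supportAssignment p ℓ (Lam F q X p k ℓ f) f = supportVector ℓ i ∧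
      ∀ᶠ f' in 𝓝 f, Lam F q X p k ℓ f' = supportWidth p (supportVector ℓ i) f' := by
  have hcont : Continuous (Lam F q X p k ℓ) := (lipschitzWith_Lam F q X p hk hℓ).continuous
  obtain ⟨i, hi⟩ := (hasSupport_of_Lam_pos X F q p hk hℓ hpos).exists_isActive
  have hiw := hi.supportWidth_eq hℓ hpos.le
  refine ⟨i, supportAssignment_eq ⟨i, hi⟩ fun j hj => ?_, ?_⟩
  · by_contra hne
    exact hgen j i hne ((hj.supportWidth_eq hℓ hpos.le).trans hiw.symm)
  -- At `f` every other support vector has a width different from `Λ(f)`. This is an open condition,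
  -- so none of them can be active nearby, while some vector has to be.
  · have hfar : ∀ j : Bool × (X.faces ⊕ X.faces ⊕ X.faces × X.faces), ∀ᶠ f' in 𝓝 f,
        supportVector ℓ j ≠ supportVector ℓ i →
          supportWidth p (supportVector ℓ j) f' ≠ Lam F q X p k ℓ f' := by
      intro j
      by_cases hj : supportVector ℓ j = supportVector ℓ i
      · exact Eventually.of_forall fun _ h => absurd hj h
      · filter_upwards [(isOpen_ne_fun (continuous_supportWidth p _) hcont).mem_nhds
          (hiw ▸ hgen j i hj)] with f' hf' _ using hf'
    filter_upwards [eventually_all.2 hfar, hcont.continuousAt.eventually (lt_mem_nhds hpos)]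
      with f' hf' hpos'
    obtain ⟨j, hj⟩ := (hasSupport_of_Lam_pos X F q p hk hℓ hpos').exists_isActive
    have hjw := hj.supportWidth_eq hℓ hpos'.le
    by_cases hji : supportVector ℓ j = supportVector ℓ i
    · rw [← hji, hjw]
    · exact absurd hjw (hf' j hji)

end Main

end GRIL

end

/-! ### The proposition -/

theorem mainTheorem4 {F : Type*} [Field F] {V : Type*} [LinearOrder V] (q : ℕ)
    (X : PreAbstractSimplicialComplex V) [Fintype X.faces] (hX : X.faces.Nonempty)
    (p : ℝ × ℝ) (k ℓ : ℕ) (hk : 1 ≤ k) (hℓ : 1 ≤ ℓ) :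
    ∃ Z : Set (X.faces → ℝ × ℝ), volume Z = 0 ∧
      ∀ f : X.faces → ℝ × ℝ, f ∉ Z →
        (∀ σ τ : X.faces, σ ≠ τ → (f σ).1 ≠ (f τ).1 ∧ (f σ).2 ≠ (f τ).2) →
        ∃ s : X.faces → ℝ × ℝ,
          (∀ σ, (s σ).1 ∈ ({1, -1, 0, (ℓ : ℝ), -(ℓ : ℝ)} : Set ℝ) ∧
            (s σ).2 ∈ ({1, -1, 0, (ℓ : ℝ), -(ℓ : ℝ)} : Set ℝ)) ∧
          s ≠ 0 ∧
          (0 < GRIL.Lam F q X p k ℓ f →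
            s = GRIL.supportAssignment p ℓ (GRIL.Lam F q X p k ℓ f) f) ∧
          (∀ g : X.faces → ℝ × ℝ, g ≠ 0 →
            ∃ d : ℝ, GRIL.HasNormalizedDeriv (GRIL.Lam F q X p k ℓ) f g d) ∧
          ∃ D : ℝ, GRIL.HasNormalizedDeriv (GRIL.Lam F q X p k ℓ) f s D ∧
            IsGreatest {d : ℝ | ∃ g : X.faces → ℝ × ℝ, g ≠ 0 ∧
              GRIL.HasNormalizedDeriv (GRIL.Lam F q X p k ℓ) f g d} D := by
  classical
  have hlip := GRIL.lipschitzWith_Lam F q X p hk hℓ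
  -- Points of non-differentiability are discarded for the case `Λ(f) = 0`, ties between support
  -- widths for the case `Λ(f) > 0`.
  refine ⟨{f | ¬ DifferentiableAt ℝ (GRIL.Lam F q X p k ℓ) f} ∪
    ⋃ (i : Bool × (X.faces ⊕ X.faces ⊕ X.faces × X.faces))
      (j : Bool × (X.faces ⊕ X.faces ⊕ X.faces × X.faces)),
      {f | GRIL.supportVector ℓ i ≠ GRIL.supportVector ℓ j ∧
        GRIL.supportWidth p (GRIL.supportVector ℓ i) f =
          GRIL.supportWidth p (GRIL.supportVector ℓ j) f}, ?_, fun f hf _ => ?_⟩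
  · refine measure_union_null (ae_iff.1 hlip.ae_differentiableAt)
      (measure_iUnion_null fun i => measure_iUnion_null fun j => ?_)
    by_cases hij : GRIL.supportVector ℓ i = GRIL.supportVector ℓ j
    · simp [hij]
    · exact measure_mono_null (fun f hf => hf.2) (GRIL.volume_supportWidth_eq p
        (GRIL.supportVector_ne_zero hℓ i) (GRIL.supportVector_ne_zero hℓ j) hij)
  rw [mem_union, not_or, mem_ofPred_eq, not_not] at hf
  obtain ⟨hdiff, hgen⟩ := hf
  simp only [mem_iUnion, not_exists, mem_ofPred_eq, not_and] at hgen
  rcases (GRIL.Lam_nonneg F q X p k ℓ f).eq_or_lt with h0 | hpos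
  · have hder : ∀ g : X.faces → ℝ × ℝ,
        GRIL.HasNormalizedDeriv (GRIL.Lam F q X p k ℓ) f g 0 := by
      intro g
      have hmin : IsLocalMin (GRIL.Lam F q X p k ℓ) f :=
        Eventually.of_forall fun f' => h0 ▸ GRIL.Lam_nonneg F q X p k ℓ f'
      have := GRIL.hasNormalizedDeriv_of_hasFDerivAt hdiff.hasFDerivAt g
      rwa [hmin.fderiv_eq_zero, _root_.zero_apply, zero_div] at this
    -- All derivatives are `0`, so any nonzero assignment is a maximizer; it exists because the
    -- complex is nonempty.
    have hs : (fun _ : X.faces => ((1 : ℝ), (1 : ℝ))) ≠ 0 := by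
      obtain ⟨σ, hσ⟩ := hX
      intro h
      have := congrArg Prod.fst (congrFun h ⟨σ, hσ⟩)
      exact one_ne_zero this
    refine ⟨fun _ => (1, 1), fun σ => by simp, hs, fun hpos => absurd h0 hpos.ne,
      fun g _ => ⟨0, hder g⟩, 0, hder _, ⟨_, hs, hder _⟩, ?_⟩
    rintro d ⟨g, -, hg⟩
    exact (hg.unique (hder g)).le
  · obtain ⟨i, hi, hev⟩ := GRIL.eventually_Lam_eq_supportWidth hk hℓ hgen hpos
    set c := GRIL.supportVector ℓ i with hc
    have hc0 : c ≠ 0 := GRIL.supportVector_ne_zero hℓ i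
    have hcc := GRIL.dot_self_pos hc0
    have hder : ∀ g : X.faces → ℝ × ℝ, GRIL.HasNormalizedDeriv (GRIL.Lam F q X p k ℓ) f g
        (GRIL.dot c g / GRIL.dot c c / ‖g‖) := by
      intro g
      refine GRIL.hasNormalizedDeriv_of_eventually ?_
      have hlim : Tendsto (fun α : ℝ => f + α • g) (𝓝 0) (𝓝 f) := by
        have : Continuous fun α : ℝ => f + α • g := by fun_prop
        simpa using this.tendsto 0
      filter_upwards [hlim.eventually hev] with α hα
      rw [hα, hev.self_of_nhds, GRIL.supportWidth_add_smul]
    refine ⟨c, fun σ => ?_, hc0, fun _ => hi.symm, fun g _ => ⟨_, hder g⟩, _, hder c,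
      ⟨c, hc0, hder c⟩, ?_⟩
    · rw [← hi]
      constructor <;> dsimp only [GRIL.supportAssignment] <;> split_ifs <;> simp
    · rintro d ⟨g, hg, hgd⟩
      -- After clearing denominators, the claim is the Hölder bound for `c` multiplied by `c·c`.
      rw [hgd.unique (hder g), div_div, div_div, div_le_div_iff₀
        (mul_pos hcc (norm_pos_iff.2 hg)) (mul_pos hcc (norm_pos_iff.2 hc0))]
      have := mul_le_mul_of_nonneg_left (GRIL.dot_supportVector_mul_norm_le ℓ i g) hcc.le
      rw [← hc] at this
      linarith
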